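/- Let $A\in\mathbb{R}^{n\times n}$, $B\in\mathbb{R}^{n\times m}$, let $H=\begin{pmatrix}Q&S^\top\\S&R\end{pmatrix}$ be a symmetric (possibly indefinite) stage cost matrix, and put $\ell(x,u)=\begin{pmatrix}x\\u\end{pmatrix}^{\!\top}H\begin{pmatrix}x\\u\end{pmatrix}$. Assume that $(A,B)$ is controllable and that the problem is (quadratically) strictly pre-dissipative: there is a symmetric matrix $\Lambda$ (not necessarily semidefinite) with $$H_\Lambda=\begin{pmatrix}Q+\Lambda-A^\top\Lambda A& S^\top-A^\top\Lambda B\\ S-B^\top\Lambda A& R-B^\top\Lambda B\end{pmatrix}\succ0 .$$ *Reverse Riccati equation.* If $A$ is invertible, put $\bar A=A^{-1}$, $\bar B=A^{-1}B$, $\bar Q=-\bar A^\top Q\bar A$, $\bar S=S\bar A-\bar B^\top Q\bar A$, $\bar R=-R+S\bar B+\bar B^\top S^\top-\bar B^\top Q\bar B$. A stabilizing solution of the RDARE is a symmetric matrix $\bar P$ such that $\bar R+\bar B^\top\bar P\bar B$ is invertible and, with $\bar K=(\bar R+\bar B^\top\bar P\bar B)^{-1}(\bar S+\bar B^\top\bar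 P\bar A)$, $$\bar P=\bar Q+\bar A^\top\bar P\bar A-(\bar S^\top+\bar A^\top\bar P\bar B)\bar K,$$ and all eigenvalues of $\bar A-\bar B\bar K$ have modulus $<1$. For general $A$, one chooses $\hat K\in\mathbb{R}^{m\times n}$ with $A-B\hat K$ invertible and takes the RDARE of the pre-stabilized data $A-B\hat K$, $B$, $Q-S^\top\hat K-\hat K^\top S+\hat K^\top R\hat K$, $S-R\hat K$, $R$ (with $\hat K=0$ allowed if $A$ is invertible). *Receding-horizon closed loop.* Given a terminal cost matrix $P^{\mathrm f}$ and a horizon $N\ge1$, at each time $j$ one solves, from the current state $\hat x_j$, $$\min\ \sum_{k=0}^{N-1}\ell(x_k,u_k)+x_N^\top P^{\mathrm f}x_N\quad\text{s.t.}\quad x_0=\hat x_j,\ \ x_{k+1}=Ax_k+Bu_k\ \ (0\le k<N),$$ without any terminal or other constraints, and sets $\hat x_{j+1}=A\hat x_j+Bu_0^\star$, where $u_0^\star$ is the first input of an optimal solution. **Theorem.** There is a $\hat K$ with $A-B\hat K$ invertible, and for every such $\hat K$ the RDARE of the pre-stabilized data has a unique stabilizing solution $\bar P_{\mathrm s}$.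 For every such $\hat K$ and every symmetric $P^{\mathrm f}\succ\bar P_{\mathrm s}$ there is an $N_0$ such that for all finite horizons $N\ge \max(N_0,1)$ the optimal control problem has exactly one optimal solution for every initial state, and the origin is globally asymptotically stable for the closed loop (Lyapunov stable, and every closed-loop trajectory converges to $0$), and in fact globally exponentially stable: there are $C>0$ and $\rho\in(0,1)$ with $\|\hat x_j\|\le C\rho^j\|\hat x_0\|$ for all $j\ge0$ and all closed-loop trajectories. -/

import Mathlib

open scoped Matrix

/-- Data of a linear-quadratic problem: the dynamics `x⁺ = A x + B u` on `ℝⁿ × ℝᵐ` and the blocks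
of the stage cost matrix `H = [[Q, Sᵀ], [S, R]]`. -/
structure LQProblem (n m : ℕ) where
  A : Matrix (Fin n) (Fin n) ℝ
  B : Matrix (Fin n) (Fin m) ℝ
  Q : Matrix (Fin n) (Fin n) ℝ
  S : Matrix (Fin m) (Fin n) ℝ
  R : Matrix (Fin m) (Fin m) ℝ

/-- All complex eigenvalues of the real square matrix `M` have modulus `< 1`. -/
def SchurStable {n : ℕ} (M : Matrix (Fin n) (Fin n) ℝ) : Prop :=
  ∀ μ ∈ spectrum ℂ (M.map Complex.ofReal), ‖μ‖ < 1

/-- The Euclidean norm of a vector in `ℝⁿ`. -/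
noncomputable def euclNorm {n : ℕ} (v : Fin n → ℝ) : ℝ := ‖WithLp.toLp 2 v‖

namespace LQProblem

variable {n m : ℕ}

/-- The stage cost matrix `H`. -/
def stageMatrix (p : LQProblem n m) : Matrix (Fin n ⊕ Fin m) (Fin n ⊕ Fin m) ℝ :=
  Matrix.fromBlocks p.Q p.Sᵀ p.S p.R

/-- The stage cost `ℓ(x, u) = [x; u]ᵀ H [x; u]`. -/
def stageCost (p : LQProblem n m) (x : Fin n → ℝ) (u : Fin m → ℝ) : ℝ :=
  Sum.elim x u ⬝ᵥ (p.stageMatrix *ᵥ Sum.elim x u)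

/-- `(x₀, …, x_N)`, `(u₀, …, u_{N-1})` satisfy the dynamics and start at `x0`. -/
def IsFeasible (p : LQProblem n m) {N : ℕ} (x0 : Fin n → ℝ)
    (x : Fin (N + 1) → Fin n → ℝ) (u : Fin N → Fin m → ℝ) : Prop :=
  x 0 = x0 ∧ ∀ k : Fin N, x k.succ = p.A *ᵥ x k.castSucc + p.B *ᵥ u k

/-- `(A, B)` is controllable: every state can be steered to every state in finitely many steps. -/
def Controllable (p : LQProblem n m) : Prop :=
  ∀ x0 x1 : Fin n → ℝ, ∃ (T : ℕ) (x : Fin (T + 1) → Fin n → ℝ) (u : Fin T → Fin m → ℝ),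
    p.IsFeasible x0 x u ∧ x (Fin.last T) = x1

/-- The problem with the stage cost rotated by the storage function `λ(x) = xᵀ Λ x`. -/
def rotate (p : LQProblem n m) (L : Matrix (Fin n) (Fin n) ℝ) : LQProblem n m where
  A := p.A
  B := p.B
  Q := p.Q + L - p.Aᵀ * L * p.A
  S := p.S - p.Bᵀ * L * p.A
  R := p.R - p.Bᵀ * L * p.B

/-- Quadratic strict `(x,u)`-pre-dissipativity: `H_Λ ≻ 0` for some symmetric `Λ`, of any signature.
`Matrix.PosDef` includes symmetry of `H_Λ`, so this forces `Q` and `R` to be symmetric. -/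
def StrictlyPreDissipative (p : LQProblem n m) : Prop :=
  ∃ L : Matrix (Fin n) (Fin n) ℝ, L.IsSymm ∧ (p.rotate L).stageMatrix.PosDef

/-- The problem obtained by the change of input `v = u + K x`, so that `x⁺ = (A - B K) x + B v`. -/
def preStabilize (p : LQProblem n m) (K : Matrix (Fin m) (Fin n) ℝ) : LQProblem n m where
  A := p.A - p.B * K
  B := p.B
  Q := p.Q - p.Sᵀ * K - Kᵀ * p.S + Kᵀ * p.R * K
  S := p.S - p.R * K
  R := p.R

/-- The data `(Ā, B̄, Q̄, S̄, R̄)` of the reverse Riccati equation (used only for invertible `A`). -/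
noncomputable def reverse (p : LQProblem n m) : LQProblem n m where
  A := p.A⁻¹
  B := p.A⁻¹ * p.B
  Q := -((p.A⁻¹)ᵀ * p.Q * p.A⁻¹)
  S := p.S * p.A⁻¹ - (p.A⁻¹ * p.B)ᵀ * p.Q * p.A⁻¹
  R := -p.R + p.S * (p.A⁻¹ * p.B) + (p.A⁻¹ * p.B)ᵀ * p.Sᵀ
    - (p.A⁻¹ * p.B)ᵀ * p.Q * (p.A⁻¹ * p.B)

/-- The gain `K = (R + Bᵀ P B)⁻¹ (S + Bᵀ P A)`. -/
noncomputable def dareGain (p : LQProblem n m) (P : Matrix (Fin n) (Fin n) ℝ) :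
    Matrix (Fin m) (Fin n) ℝ :=
  (p.R + p.Bᵀ * P * p.B)⁻¹ * (p.S + p.Bᵀ * P * p.A)

/-- `P` is a (symmetric) solution of the discrete algebraic Riccati equation of `p`. -/
def IsDARESolution (p : LQProblem n m) (P : Matrix (Fin n) (Fin n) ℝ) : Prop :=
  P.IsSymm ∧ IsUnit (p.R + p.Bᵀ * P * p.B) ∧
    P = p.Q + p.Aᵀ * P * p.A - (p.Sᵀ + p.Aᵀ * P * p.B) * p.dareGain P

/-- `P` is a stabilizing solution of the DARE of `p`. -/
def IsStabilizingDARESolution (p : LQProblem n m) (P : Matrix (Fin n) (Fin n) ℝ) : Prop :=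
  p.IsDARESolution P ∧ SchurStable (p.A - p.B * p.dareGain P)

/-- `P` is a stabilizing solution of the reverse DARE of `p`, i.e. of the DARE with the data
`p.reverse`. -/
def IsStabilizingRDARESolution (p : LQProblem n m) (P : Matrix (Fin n) (Fin n) ℝ) : Prop :=
  p.reverse.IsStabilizingDARESolution P

/-- The objective `∑_{k<N} ℓ(x_k, u_k) + x_Nᵀ Pf x_N`. -/
def horizonCost (p : LQProblem n m) (Pf : Matrix (Fin n) (Fin n) ℝ) {N : ℕ}
    (x : Fin (N + 1) → Fin n → ℝ) (u : Fin N → Fin m → ℝ) : ℝ :=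
  ∑ k : Fin N, p.stageCost (x k.castSucc) (u k) +
    x (Fin.last N) ⬝ᵥ (Pf *ᵥ x (Fin.last N))

/-- `(x, u)` solves the optimal control problem of horizon `N` with initial state `x0` and terminal
cost matrix `Pf`; there are no terminal (or other) constraints. -/
def IsOptimal (p : LQProblem n m) (Pf : Matrix (Fin n) (Fin n) ℝ) {N : ℕ} (x0 : Fin n → ℝ)
    (x : Fin (N + 1) → Fin n → ℝ) (u : Fin N → Fin m → ℝ) : Prop :=
  p.IsFeasible x0 x u ∧
    ∀ (x' : Fin (N + 1) → Fin n → ℝ) (u' : Fin N → Fin m → ℝ),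
      p.IsFeasible x0 x' u' → p.horizonCost Pf x u ≤ p.horizonCost Pf x' u'

/-- `z` is a trajectory of the receding-horizon closed loop: at each time `j`, the problem of horizon
`N` is solved from the current state `z j` and the first optimal input is applied. -/
def IsClosedLoop (p : LQProblem n m) (Pf : Matrix (Fin n) (Fin n) ℝ) (N : ℕ) (hN : 0 < N)
    (z : ℕ → Fin n → ℝ) : Prop :=
  ∀ j : ℕ, ∃ (x : Fin (N + 1) → Fin n → ℝ) (u : Fin N → Fin m → ℝ),
    p.IsOptimal Pf (z j) x u ∧ z (j + 1) = p.A *ᵥ z j + p.B *ᵥ u ⟨0, hN⟩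

end LQProblem

/-- Global asymptotic stability of the origin for a set `T` of trajectories:
Lyapunov stability and global attractivity. -/
def GloballyAsymptoticallyStable {n : ℕ} (T : Set (ℕ → Fin n → ℝ)) : Prop :=
  (∀ ε > 0, ∃ δ > 0, ∀ z ∈ T, euclNorm (z 0) < δ → ∀ j, euclNorm (z j) < ε) ∧
    ∀ z ∈ T, Filter.Tendsto z Filter.atTop (nhds 0)

/-- Global exponential stability of the origin for a set `T` of trajectories. -/
def GloballyExponentiallyStable {n : ℕ} (T : Set (ℕ → Fin n → ℝ)) : Prop :=
  ∃ C > 0, ∃ ρ : ℝ, 0 < ρ ∧ ρ < 1 ∧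
    ∀ z ∈ T, ∀ j : ℕ, euclNorm (z j) ≤ C * ρ ^ j * euclNorm (z 0)

/-!
Let `L` witness strict pre-dissipativity. Rotating the stage cost by `L` makes it positive definite
and changes the cost of all feasible trajectories with a given initial state by the same constant
if the terminal cost matrix `Pf` is replaced by `F = Pf + L` (`horizonCost_rotate`). So the stage
cost `ℓ` may be taken positive definite, at the price of an indefinite terminal cost.

The reverse Riccati equation is the Riccati equation of the dynamics run backwards, with cost `-ℓ`.
Changing the sign gives an ordinary regulator problem with positive definite cost, whose
stabilizing solution `W` exists by the monotone bounded Riccati iteration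
(`HasPosDefCost.exists_stabilizing`) and is unique
(`IsStabilizingDARESolution.unique`). Hence the stabilizing solution of the reverse equation is
`-W - L`, the hypothesis on `Pf` reads `F + W ≻ 0`, and `W` is a storage function:
`W(x⁺) ≤ ℓ(x, u) + W(x)` (`exists_requiredSupply`); here and below a matrix also denotes its
quadratic form.

The storage inequality shows that dynamic programming preserves `P + W ≻ 0`
(`HasStorageBound.riccati`), which keeps every one-step problem strictly convex; this gives a
unique optimal solution for every horizon, realized by the Riccati feedback.

Let `Y` be the stabilizing solution of the forward regulator problem. The Riccati iterates `P_k`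
from `F` converge to `Y` in the multiplicative sense `(1 - ε) Y ≤ P_k ≤ (1 + ε) Y`. For the upper
bound, apply the stationary optimal feedback. For the lower bound, `F ≥ -(1 - δ) W` for some
`δ > 0`; in each step the part of `ℓ` that is not spent on the storage inequality raises the bound
by a fixed multiple of `W`, until it is nonnegative, and from then on the defect in
`P_k ≥ (1 - ε) Y` contracts geometrically. Therefore `Y` decreases by a fixed factor along the
closed loop of every sufficiently long horizon (`HasStorageBound.exists_horizon_stable`).
-/

open Filter Topology

/-! ### Quadratic forms -/

/-- The quadratic form `x ↦ xᵀ M x` of a square matrix. -/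
def quadForm {k : ℕ} (M : Matrix (Fin k) (Fin k) ℝ) (x : Fin k → ℝ) : ℝ := x ⬝ᵥ (M *ᵥ x)

section QuadForm

variable {k l : ℕ}

theorem mulVec_dotProduct_eq (M : Matrix (Fin k) (Fin l) ℝ) (x : Fin l → ℝ) (y : Fin k → ℝ) :
    (M *ᵥ x) ⬝ᵥ y = x ⬝ᵥ (Mᵀ *ᵥ y) := by
  rw [Matrix.dotProduct_mulVec, Matrix.vecMul_transpose]

theorem dotProduct_mulVec_comm (M : Matrix (Fin k) (Fin l) ℝ) (x : Fin k → ℝ) (y : Fin l → ℝ) :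
    x ⬝ᵥ (M *ᵥ y) = y ⬝ᵥ (Mᵀ *ᵥ x) := by
  rw [dotProduct_comm, mulVec_dotProduct_eq]

theorem quadForm_add (M N : Matrix (Fin k) (Fin k) ℝ) (x : Fin k → ℝ) :
    quadForm (M + N) x = quadForm M x + quadForm N x := by
  simp [quadForm, Matrix.add_mulVec]

@[simp] theorem quadForm_zero_right (M : Matrix (Fin k) (Fin k) ℝ) : quadForm M 0 = 0 := by
  simp [quadForm]

@[simp] theorem quadForm_zero_left (x : Fin k → ℝ) :
    quadForm (0 : Matrix (Fin k) (Fin k) ℝ) x = 0 := by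
  simp [quadForm]

theorem quadForm_smul (M : Matrix (Fin k) (Fin k) ℝ) (c : ℝ) (x : Fin k → ℝ) :
    quadForm M (c • x) = c ^ 2 * quadForm M x := by
  simp [quadForm, Matrix.mulVec_smul]; ring

theorem continuous_quadForm (M : Matrix (Fin k) (Fin k) ℝ) : Continuous (quadForm M) := by
  unfold quadForm; fun_prop

theorem quadForm_one (x : Fin k → ℝ) : quadForm 1 x = euclNorm x ^ 2 := by
  simp [quadForm, euclNorm, EuclideanSpace.norm_eq, dotProduct, sq]
  rw [Real.mul_self_sqrt (Finset.sum_nonneg fun i _ => mul_self_nonneg _)]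

theorem posDef_iff_quadForm {M : Matrix (Fin k) (Fin k) ℝ} :
    M.PosDef ↔ M.IsSymm ∧ ∀ x, x ≠ 0 → 0 < quadForm M x := by
  rw [Matrix.posDef_iff_dotProduct_mulVec]
  simp only [Matrix.IsHermitian, Matrix.conjTranspose_eq_transpose_of_trivial, Matrix.IsSymm,
    star_trivial, quadForm]

theorem quadForm_pos_of_posDef {M : Matrix (Fin k) (Fin k) ℝ} (h : M.PosDef) {x : Fin k → ℝ}
    (hx : x ≠ 0) : 0 < quadForm M x :=
  (posDef_iff_quadForm.1 h).2 x hx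

theorem quadForm_nonneg_of_posDef {M : Matrix (Fin k) (Fin k) ℝ} (h : M.PosDef) (x : Fin k → ℝ) :
    0 ≤ quadForm M x := by
  rcases eq_or_ne x 0 with rfl | hx
  · simp
  · exact (quadForm_pos_of_posDef h hx).le

/-- Polarization: the entries of a symmetric matrix in terms of its quadratic form. -/
theorem entry_eq_quadForm {M : Matrix (Fin k) (Fin k) ℝ} (h : M.IsSymm) (i j : Fin k) :
    M i j = (quadForm M (Pi.single i 1 + Pi.single j 1) - quadForm M (Pi.single i 1)
      - quadForm M (Pi.single j 1)) / 2 := by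
  have hij : M j i = M i j := h.apply i j
  simp [quadForm, Matrix.mulVec_add, hij]
  ring

/-- Two continuous functions that are homogeneous of degree two on a finite-dimensional space are
comparable if the larger one is to be positive off the origin. -/
theorem exists_mul_le_of_homogeneous {E : Type*} [NormedAddCommGroup E] [NormedSpace ℝ E]
    [FiniteDimensional ℝ E] {φ ψ : E → ℝ} (hφ : Continuous φ) (hψ : Continuous ψ)
    (hφ2 : ∀ (c : ℝ) x, φ (c • x) = c ^ 2 * φ x) (hψ2 : ∀ (c : ℝ) x, ψ (c • x) = c ^ 2 * ψ x)
    (hpos : ∀ x, x ≠ 0 → 0 < ψ x) : ∃ c > 0, ∀ x, c * φ x ≤ ψ x := by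
  have hK : IsCompact (Metric.sphere (0 : E) 1) := isCompact_sphere 0 1
  have hne : ∀ x ∈ Metric.sphere (0 : E) 1, x ≠ 0 := by
    rintro x hx rfl; simp at hx
  have hc : ContinuousOn (fun x => φ x / ψ x) (Metric.sphere (0 : E) 1) :=
    hφ.continuousOn.div hψ.continuousOn fun x hx => (hpos x (hne x hx)).ne'
  obtain ⟨b, hb⟩ := (hK.image_of_continuousOn hc).bddAbove
  have hb' : ∀ x ∈ Metric.sphere (0 : E) 1, φ x ≤ max b 1 * ψ x := fun x hx => by
    have h1 : φ x / ψ x ≤ b := hb ⟨x, hx, rfl⟩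
    exact (div_le_iff₀ (hpos x (hne x hx))).1 (h1.trans (le_max_left _ _))
  have hB : 0 < max b 1 := lt_max_of_lt_right one_pos
  refine ⟨(max b 1)⁻¹, inv_pos.2 hB, fun x => ?_⟩
  rw [inv_mul_le_iff₀ hB]
  rcases eq_or_ne x 0 with rfl | hx
  · have h1 := hφ2 0 0
    have h2 := hψ2 0 0
    simp at h1 h2
    simp [h1, h2]
  · have hn : ‖x‖ ≠ 0 := norm_ne_zero_iff.2 hx
    have h1 := hb' (‖x‖⁻¹ • x) (by simp [norm_smul, hn])
    rw [hφ2, hψ2, mul_left_comm] at h1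
    exact le_of_mul_le_mul_left h1 (by positivity)

theorem exists_mul_quadForm_le {M : Matrix (Fin k) (Fin k) ℝ} (N : Matrix (Fin k) (Fin k) ℝ)
    (hM : ∀ x, x ≠ 0 → 0 < quadForm M x) : ∃ c > 0, ∀ x, c * quadForm N x ≤ quadForm M x :=
  exists_mul_le_of_homogeneous (continuous_quadForm N) (continuous_quadForm M)
    (fun c x => quadForm_smul N c x) (fun c x => quadForm_smul M c x) hM

end QuadForm

/-! ### Schur stability -/

section Schur

variable {n : ℕ}

/-- Lyapunov's criterion: an eigenvector `a + i b` for `μ` satisfies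
`q (M a) + q (M b) = ‖μ‖² (q a + q b)`, where `q` is the quadratic form of `Y`. -/
theorem schurStable_of_lyapunov {M Y : Matrix (Fin n) (Fin n) ℝ} (hY : Y.PosDef) {c : ℝ}
    (hc : c < 1) (h : ∀ x, quadForm Y (M *ᵥ x) ≤ c * quadForm Y x) : SchurStable M := by
  intro μ hμ
  rw [← Matrix.spectrum_toLin', ← Module.End.hasEigenvalue_iff_mem_spectrum] at hμ
  obtain ⟨v, hv⟩ := hμ.exists_hasEigenvector
  have hMv : M.map Complex.ofReal *ᵥ v = μ • v := by
    simpa using hv.apply_eq_smul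
  set a : Fin n → ℝ := fun i => (v i).re with ha
  set b : Fin n → ℝ := fun i => (v i).im with hb
  have hMa : M *ᵥ a = μ.re • a - μ.im • b := by
    ext i
    have := congrArg Complex.re (congrFun hMv i)
    simpa [Matrix.mulVec, dotProduct, a, b] using this
  have hMb : M *ᵥ b = μ.re • b + μ.im • a := by
    ext i
    have := congrArg Complex.im (congrFun hMv i)
    simpa [Matrix.mulVec, dotProduct, a, b] using this
  have hpos : 0 < quadForm Y a + quadForm Y b := by
    rcases eq_or_ne a 0 with h0 | h0
    · have hb0 : b ≠ 0 := by
        intro hb0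
        exact hv.2 (by ext i; exact Complex.ext (congrFun h0 i) (congrFun hb0 i))
      have := quadForm_pos_of_posDef hY hb0
      have := quadForm_nonneg_of_posDef hY a
      linarith
    · have := quadForm_pos_of_posDef hY h0
      have := quadForm_nonneg_of_posDef hY b
      linarith
  have hsum : quadForm Y (M *ᵥ a) + quadForm Y (M *ᵥ b)
      = ‖μ‖ ^ 2 * (quadForm Y a + quadForm Y b) := by
    rw [hMa, hMb, Complex.sq_norm, Complex.normSq_apply]
    simp [quadForm, Matrix.mulVec_add, Matrix.mulVec_sub, Matrix.mulVec_smul]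
    ring
  have h1 := h a
  have h2 := h b
  have h3 : ‖μ‖ ^ 2 * (quadForm Y a + quadForm Y b) ≤ c * (quadForm Y a + quadForm Y b) := by
    linarith
  have h4 := le_of_mul_le_mul_right h3 hpos
  nlinarith [norm_nonneg μ]

/-- Gelfand's formula gives the decay of the powers of an element of spectral radius `< 1`. -/
theorem tendsto_pow_of_spectralRadius_lt_one {𝔸 : Type*} [NormedRing 𝔸] [NormedAlgebra ℂ 𝔸]
    [CompleteSpace 𝔸] {a : 𝔸} (h : spectralRadius ℂ a < 1) :
    Tendsto (fun k : ℕ => a ^ k) atTop (𝓝 0) := by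
  obtain ⟨r, hr1, hr2⟩ := exists_between h
  have hev : ∀ᶠ k : ℕ in atTop, (‖a ^ k‖₊ : ENNReal) ≤ r ^ k := by
    filter_upwards [(spectrum.pow_nnnorm_pow_one_div_tendsto_nhds_spectralRadius a).eventually_lt_const
      hr1, eventually_gt_atTop 0] with k hk hk0
    have hk' : (0 : ℝ) < k := Nat.cast_pos.2 hk0
    have h1 := ENNReal.rpow_le_rpow hk.le hk'.le
    rwa [← ENNReal.rpow_mul, one_div, inv_mul_cancel₀ hk'.ne', ENNReal.rpow_one,
      ENNReal.rpow_natCast] at h1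
  have hz : Tendsto (fun k : ℕ => (‖a ^ k‖₊ : ENNReal)) atTop (𝓝 0) :=
    tendsto_of_tendsto_of_tendsto_of_le_of_le' tendsto_const_nhds
      (ENNReal.tendsto_pow_atTop_nhds_zero_of_lt_one hr2) (Eventually.of_forall fun _ => zero_le)
      hev
  rw [tendsto_zero_iff_norm_tendsto_zero]
  have h2 := (ENNReal.tendsto_toReal ENNReal.zero_ne_top).comp hz
  simpa [Function.comp_def] using h2

attribute [local instance] Matrix.linftyOpNormedRing Matrix.linftyOpNormedAlgebra in
theorem SchurStable.tendsto_pow {M : Matrix (Fin n) (Fin n) ℝ} (h : SchurStable M) :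
    Tendsto (fun k => M ^ k) atTop (𝓝 0) := by
  have hC : Tendsto (fun k => (M.map Complex.ofReal) ^ k) atTop (𝓝 0) := by
    rcases subsingleton_or_nontrivial (Matrix (Fin n) (Fin n) ℂ) with hs | hs
    · exact tendsto_const_nhds.congr fun k => Subsingleton.elim _ _
    apply tendsto_pow_of_spectralRadius_lt_one
    simpa using spectrum.spectralRadius_lt_of_forall_lt (M.map Complex.ofReal) (r := 1)
      (fun μ hμ => by simpa [← NNReal.coe_lt_coe] using h μ hμ)
  refine tendsto_pi_nhds.2 fun i => tendsto_pi_nhds.2 fun j => ?_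
  have h2 := (Complex.continuous_re.tendsto _).comp
    (tendsto_pi_nhds.1 (tendsto_pi_nhds.1 hC i) j)
  refine h2.congr fun k => ?_
  have hmap : (M.map Complex.ofReal) ^ k = (M ^ k).map Complex.ofReal :=
    (map_pow (Complex.ofRealHom.mapMatrix (m := Fin n)) M k).symm
  simp [hmap]

end Schur

namespace LQProblem

/-! ### Stage costs and the Riccati operator -/

section Algebra

variable {n m : ℕ} (p : LQProblem n m)

theorem stageCost_eq (x : Fin n → ℝ) (u : Fin m → ℝ) :
    p.stageCost x u = x ⬝ᵥ (p.Q *ᵥ x) + 2 * (u ⬝ᵥ (p.S *ᵥ x)) + u ⬝ᵥ (p.R *ᵥ u) := by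
  have h : x ⬝ᵥ (p.Sᵀ *ᵥ u) = u ⬝ᵥ (p.S *ᵥ x) := by
    rw [dotProduct_mulVec_comm, Matrix.transpose_transpose]
  simp only [stageCost, stageMatrix, Matrix.fromBlocks_mulVec, Sum.elim_comp_inl,
    Sum.elim_comp_inr, sumElim_dotProduct_sumElim, dotProduct_add, h]
  ring

@[simp] theorem stageCost_zero : p.stageCost 0 0 = 0 := by simp [stageCost_eq]

theorem stageCost_smul (c : ℝ) (x : Fin n → ℝ) (u : Fin m → ℝ) :
    p.stageCost (c • x) (c • u) = c ^ 2 * p.stageCost x u := by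
  simp [stageCost_eq, Matrix.mulVec_smul]; ring

theorem continuous_stageCost :
    Continuous fun w : (Fin n → ℝ) × (Fin m → ℝ) => p.stageCost w.1 w.2 := by
  simp only [stageCost_eq]; fun_prop

theorem rotate_stageCost (L : Matrix (Fin n) (Fin n) ℝ) (hL : L.IsSymm) (x : Fin n → ℝ)
    (u : Fin m → ℝ) :
    (p.rotate L).stageCost x u
      = p.stageCost x u + quadForm L x - quadForm L (p.A *ᵥ x + p.B *ᵥ u) := by
  have h : x ⬝ᵥ ((p.Aᵀ * (L * p.B)) *ᵥ u) = u ⬝ᵥ ((p.Bᵀ * (L * p.A)) *ᵥ x) := by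
    rw [dotProduct_mulVec_comm]
    simp [Matrix.transpose_mul, hL.eq, Matrix.mul_assoc]
  simp only [stageCost_eq, rotate, quadForm, Matrix.add_mulVec, Matrix.sub_mulVec,
    Matrix.mulVec_add, dotProduct_add, dotProduct_sub, add_dotProduct, mulVec_dotProduct_eq,
    Matrix.mulVec_mulVec, Matrix.mul_assoc, h]
  ring

theorem preStabilize_stageCost (hR : p.R.IsSymm) (K : Matrix (Fin m) (Fin n) ℝ) (x : Fin n → ℝ)
    (v : Fin m → ℝ) :
    (p.preStabilize K).stageCost x v = p.stageCost x (v - K *ᵥ x) := by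
  have h1 : x ⬝ᵥ ((p.Sᵀ * K) *ᵥ x) = x ⬝ᵥ ((Kᵀ * p.S) *ᵥ x) := by
    rw [dotProduct_mulVec_comm]; simp
  have h2 : x ⬝ᵥ ((Kᵀ * p.R) *ᵥ v) = v ⬝ᵥ ((p.R * K) *ᵥ x) := by
    rw [dotProduct_mulVec_comm]; simp [hR.eq]
  simp only [stageCost_eq, preStabilize, Matrix.add_mulVec, Matrix.sub_mulVec, Matrix.mulVec_sub,
    dotProduct_add, dotProduct_sub, sub_dotProduct, mulVec_dotProduct_eq,
    Matrix.mulVec_mulVec, Matrix.mul_assoc, h1, h2]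
  ring

/-- The reverse problem runs the dynamics backwards, with input `-v` and cost `-ℓ`. -/
theorem reverse_stageCost (hQ : p.Q.IsSymm) (y : Fin n → ℝ) (v : Fin m → ℝ) :
    p.reverse.stageCost y v
      = -p.stageCost (p.reverse.A *ᵥ y + p.reverse.B *ᵥ v) (-v) := by
  simp only [reverse]
  generalize p.A⁻¹ = a
  have h1 : y ⬝ᵥ ((aᵀ * (p.Q * (a * p.B))) *ᵥ v) = v ⬝ᵥ ((p.Bᵀ * (aᵀ * (p.Q * a))) *ᵥ y) := by
    rw [dotProduct_mulVec_comm]; simp [hQ.eq, Matrix.mul_assoc]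
  have h2 : v ⬝ᵥ ((p.Bᵀ * (aᵀ * p.Sᵀ)) *ᵥ v) = v ⬝ᵥ ((p.S * (a * p.B)) *ᵥ v) := by
    rw [dotProduct_mulVec_comm]; simp [Matrix.mul_assoc]
  simp only [stageCost_eq, Matrix.add_mulVec, Matrix.sub_mulVec,
    Matrix.neg_mulVec, Matrix.mulVec_neg, dotProduct_neg, neg_dotProduct, Matrix.mulVec_add,
    add_dotProduct, Matrix.transpose_mul,
    dotProduct_add, dotProduct_sub, mulVec_dotProduct_eq,
    Matrix.mulVec_mulVec, Matrix.mul_assoc, h1, h2]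
  ring

/-- The problem with the opposite stage cost. -/
def neg (p : LQProblem n m) : LQProblem n m where
  A := p.A
  B := p.B
  Q := -p.Q
  S := -p.S
  R := -p.R

theorem neg_stageCost (x : Fin n → ℝ) (u : Fin m → ℝ) :
    p.neg.stageCost x u = -p.stageCost x u := by
  simp only [stageCost_eq, neg, Matrix.neg_mulVec, dotProduct_neg]; ring

/-- The Riccati operator; the DARE is its fixed-point equation. -/
noncomputable def riccati (P : Matrix (Fin n) (Fin n) ℝ) : Matrix (Fin n) (Fin n) ℝ :=
  p.Q + p.Aᵀ * P * p.A - (p.Sᵀ + p.Aᵀ * P * p.B) * p.dareGain P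

/-- The matrix `R + Bᵀ P B` of the part that is quadratic in the input in the one-step problem with
terminal cost matrix `P`, that is, half the Hessian. -/
def inputHessian (P : Matrix (Fin n) (Fin n) ℝ) : Matrix (Fin m) (Fin m) ℝ :=
  p.R + p.Bᵀ * P * p.B

variable {p} {P : Matrix (Fin n) (Fin n) ℝ}

theorem inputHessian_isSymm (hR : p.R.IsSymm) (hP : P.IsSymm) : (p.inputHessian P).IsSymm := by
  simp [inputHessian, Matrix.IsSymm, Matrix.transpose_mul, hR.eq, hP.eq, Matrix.mul_assoc]

theorem inputHessian_mul_dareGain (hM : IsUnit (p.inputHessian P)) :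
    p.inputHessian P * p.dareGain P = p.S + p.Bᵀ * P * p.A := by
  change p.inputHessian P * ((p.inputHessian P)⁻¹ * (p.S + p.Bᵀ * P * p.A)) = _
  rw [← Matrix.mul_assoc, Matrix.mul_nonsing_inv _ ((Matrix.isUnit_iff_isUnit_det _).1 hM),
    Matrix.one_mul]

theorem dareGain_transpose_mul (hR : p.R.IsSymm) (hP : P.IsSymm)
    (hM : IsUnit (p.inputHessian P)) :
    (p.dareGain P)ᵀ * p.inputHessian P = p.Sᵀ + p.Aᵀ * P * p.B := by
  have h := congrArg Matrix.transpose (inputHessian_mul_dareGain hM)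
  simpa [Matrix.transpose_mul, (inputHessian_isSymm hR hP).eq, hP.eq, Matrix.mul_assoc] using h

theorem riccati_isSymm (hQ : p.Q.IsSymm) (hR : p.R.IsSymm) (hP : P.IsSymm)
    (hM : IsUnit (p.inputHessian P)) : (p.riccati P).IsSymm := by
  rw [riccati, ← dareGain_transpose_mul hR hP hM]
  simp [Matrix.IsSymm, Matrix.transpose_mul, hQ.eq, hP.eq, Matrix.mul_assoc,
    (inputHessian_isSymm hR hP).eq]

/-- Completion of the square in the Bellman equation. -/
theorem stageCost_add_quadForm (hR : p.R.IsSymm) (hP : P.IsSymm)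
    (hM : IsUnit (p.inputHessian P)) (x : Fin n → ℝ) (u : Fin m → ℝ) :
    p.stageCost x u + quadForm P (p.A *ᵥ x + p.B *ᵥ u)
      = quadForm (p.riccati P) x + quadForm (p.inputHessian P) (u + p.dareGain P *ᵥ x) := by
  have hMK := inputHessian_mul_dareGain hM
  have hKM := dareGain_transpose_mul hR hP hM
  have h1 : x ⬝ᵥ ((p.Aᵀ * (P * p.B)) *ᵥ u) = u ⬝ᵥ ((p.Bᵀ * (P * p.A)) *ᵥ x) := by
    rw [dotProduct_mulVec_comm]; simp [Matrix.transpose_mul, hP.eq, Matrix.mul_assoc]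
  have h2 : x ⬝ᵥ (p.Sᵀ *ᵥ u) = u ⬝ᵥ (p.S *ᵥ x) := by rw [dotProduct_mulVec_comm]; simp
  have e : quadForm (p.inputHessian P) (u + p.dareGain P *ᵥ x)
      = u ⬝ᵥ ((p.R + p.Bᵀ * P * p.B) *ᵥ u) + u ⬝ᵥ ((p.S + p.Bᵀ * P * p.A) *ᵥ x)
        + x ⬝ᵥ ((p.Sᵀ + p.Aᵀ * P * p.B) *ᵥ u)
        + x ⬝ᵥ (((p.Sᵀ + p.Aᵀ * P * p.B) * p.dareGain P) *ᵥ x) := by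
    rw [← hMK, ← hKM]
    simp only [quadForm, Matrix.mulVec_add, dotProduct_add, add_dotProduct, mulVec_dotProduct_eq,
      Matrix.mulVec_mulVec, ← Matrix.mul_assoc (p.dareGain P)ᵀ]
    rw [inputHessian]
    ring
  rw [e]
  simp only [stageCost_eq, riccati, quadForm, Matrix.add_mulVec, Matrix.sub_mulVec,
    Matrix.mulVec_add, dotProduct_add, dotProduct_sub, add_dotProduct, mulVec_dotProduct_eq,
    Matrix.mulVec_mulVec, Matrix.mul_assoc, Matrix.add_mul, h1, h2]
  ring

theorem quadForm_riccati (hR : p.R.IsSymm) (hP : P.IsSymm)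
    (hM : IsUnit (p.inputHessian P)) (x : Fin n → ℝ) :
    quadForm (p.riccati P) x = p.stageCost x (-(p.dareGain P *ᵥ x))
      + quadForm P (p.A *ᵥ x + p.B *ᵥ (-(p.dareGain P *ᵥ x))) := by
  rw [stageCost_add_quadForm hR hP hM]; simp

theorem quadForm_riccati_le (hR : p.R.IsSymm) (hP : P.IsSymm)
    (hM : (p.inputHessian P).PosDef) (x : Fin n → ℝ) (u : Fin m → ℝ) :
    quadForm (p.riccati P) x ≤ p.stageCost x u + quadForm P (p.A *ᵥ x + p.B *ᵥ u) := by
  rw [stageCost_add_quadForm hR hP hM.isUnit]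
  linarith [quadForm_nonneg_of_posDef hM (u + p.dareGain P *ᵥ x)]

theorem mulVec_add_mulVec_neg_gain (K : Matrix (Fin m) (Fin n) ℝ) (x : Fin n → ℝ) :
    p.A *ᵥ x + p.B *ᵥ (-(K *ᵥ x)) = (p.A - p.B * K) *ᵥ x := by
  rw [Matrix.sub_mulVec, Matrix.mulVec_neg, Matrix.mulVec_mulVec, sub_eq_add_neg]

/-! ### Solutions of the algebraic Riccati equation -/

theorem neg_dareGain (p : LQProblem n m) (P : Matrix (Fin n) (Fin n) ℝ)  :
    p.neg.dareGain P = p.dareGain (-P) := by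
  have h1 : -p.R + p.Bᵀ * P * p.B = -(p.R + p.Bᵀ * -P * p.B) := by
    simp only [Matrix.mul_neg,
      Matrix.neg_mul, Matrix.mul_assoc]
    abel
  have h2 : -p.S + p.Bᵀ * P * p.A = -(p.S + p.Bᵀ * -P * p.A) := by
    simp only [Matrix.mul_neg,
      Matrix.neg_mul, Matrix.mul_assoc]
    abel
  simp only [dareGain, neg, h1, h2]
  have : ∀ M : Matrix (Fin m) (Fin m) ℝ, (-M)⁻¹ = -M⁻¹ := fun M => by
    by_cases hM : IsUnit M.det
    · exact Matrix.inv_eq_left_inv (by simp [Matrix.nonsing_inv_mul _ hM])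
    -- both inverses of a singular matrix are zero by convention
    · have hM' : ¬ IsUnit (-M).det := by
        rwa [← Matrix.isUnit_iff_isUnit_det, IsUnit.neg_iff, Matrix.isUnit_iff_isUnit_det]
      rw [Matrix.nonsing_inv_apply_not_isUnit _ hM, Matrix.nonsing_inv_apply_not_isUnit _ hM',
        neg_zero]
  rw [this, Matrix.neg_mul, Matrix.mul_neg, neg_neg]

theorem neg_isStabilizingDARESolution (p : LQProblem n m) (P : Matrix (Fin n) (Fin n) ℝ) :
    p.neg.IsStabilizingDARESolution P ↔ p.IsStabilizingDARESolution (-P) := by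
  have hs : (-P).IsSymm ↔ P.IsSymm := by simp [Matrix.IsSymm]
  have hu : IsUnit (-p.R + p.Bᵀ * P * p.B) ↔ IsUnit (p.R + p.Bᵀ * -P * p.B) := by
    rw [← IsUnit.neg_iff]
    have : -(-p.R + p.Bᵀ * P * p.B) = p.R + p.Bᵀ * -P * p.B := by
      simp only [Matrix.mul_neg,
        Matrix.neg_mul, Matrix.mul_assoc]
      abel
    rw [this]
  unfold IsStabilizingDARESolution IsDARESolution
  rw [neg_dareGain, hs]
  simp only [neg, hu]
  have he : ∀ K : Matrix (Fin m) (Fin n) ℝ,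
      P = -p.Q + p.Aᵀ * P * p.A - ((-p.S)ᵀ + p.Aᵀ * P * p.B) * K ↔
      -P = p.Q + p.Aᵀ * -P * p.A - (p.Sᵀ + p.Aᵀ * -P * p.B) * K := fun K => by
    rw [← neg_inj]
    have : -(-p.Q + p.Aᵀ * P * p.A - ((-p.S)ᵀ + p.Aᵀ * P * p.B) * K)
      = p.Q + p.Aᵀ * -P * p.A - (p.Sᵀ + p.Aᵀ * -P * p.B) * K := by
        rw [Matrix.transpose_neg]
        simp only [Matrix.add_mul, Matrix.mul_neg,
          Matrix.neg_mul, Matrix.mul_assoc]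
        abel
    rw [this]
  rw [he]

theorem rotate_isStabilizingDARESolution (p : LQProblem n m) {L : Matrix (Fin n) (Fin n) ℝ}
    (hL : L.IsSymm) (P : Matrix (Fin n) (Fin n) ℝ) :
    (p.rotate L).IsStabilizingDARESolution (P + L) ↔ p.IsStabilizingDARESolution P := by
  have hs : (P + L).IsSymm ↔ P.IsSymm :=
    ⟨fun h => by simpa using h.sub hL, fun h => h.add hL⟩
  have h1 : p.R - p.Bᵀ * L * p.B + p.Bᵀ * (P + L) * p.B = p.R + p.Bᵀ * P * p.B := by
    simp only [Matrix.mul_add, Matrix.add_mul, Matrix.mul_assoc]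
    abel
  have h2 : p.S - p.Bᵀ * L * p.A + p.Bᵀ * (P + L) * p.A = p.S + p.Bᵀ * P * p.A := by
    simp only [Matrix.mul_add, Matrix.add_mul, Matrix.mul_assoc]
    abel
  have h3 : (p.S - p.Bᵀ * L * p.A)ᵀ + p.Aᵀ * (P + L) * p.B = p.Sᵀ + p.Aᵀ * P * p.B := by
    simp only [Matrix.transpose_sub, Matrix.transpose_mul, Matrix.transpose_transpose, hL.eq]
    simp only [Matrix.mul_add, Matrix.add_mul, Matrix.mul_assoc]
    abel
  have hg : (p.rotate L).dareGain (P + L) = p.dareGain P := by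
    simp only [dareGain, rotate, h1, h2]
  unfold IsStabilizingDARESolution IsDARESolution
  rw [hg, hs]
  simp only [rotate, h1, h3]
  have he : ∀ X : Matrix (Fin n) (Fin n) ℝ,
      P + L = p.Q + L - p.Aᵀ * L * p.A + p.Aᵀ * (P + L) * p.A - X ↔
      P = p.Q + p.Aᵀ * P * p.A - X := fun X => by
    have : p.Q + L - p.Aᵀ * L * p.A + p.Aᵀ * (P + L) * p.A - X
      = (p.Q + p.Aᵀ * P * p.A - X) + L := by
        simp only [Matrix.mul_add, Matrix.add_mul, Matrix.mul_assoc]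
        abel
    rw [this, add_left_inj]
  rw [he]

/-- The difference `X` of two solutions satisfies `X = A₁ᵀ X A₂` with the two closed-loop
matrices `A₁` and `A₂`. -/
theorem IsDARESolution.sub_eq {P₁ P₂ : Matrix (Fin n) (Fin n) ℝ} (hR : p.R.IsSymm)
    (h₁ : p.IsDARESolution P₁) (h₂ : p.IsDARESolution P₂) :
    P₁ - P₂ = (p.A - p.B * p.dareGain P₁)ᵀ * (P₁ - P₂) * (p.A - p.B * p.dareGain P₂) := by
  obtain ⟨s₁, u₁, e₁⟩ := h₁
  obtain ⟨s₂, u₂, e₂⟩ := h₂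
  have t₁ := dareGain_transpose_mul hR s₁ u₁
  have t₁' := inputHessian_mul_dareGain u₁
  have t₂ := inputHessian_mul_dareGain u₂
  rw [inputHessian] at t₁ t₁' t₂
  set K₁ := p.dareGain P₁
  set K₂ := p.dareGain P₂
  have a₁ : K₁ᵀ * (p.Bᵀ * P₁ * p.B) = p.Sᵀ + p.Aᵀ * P₁ * p.B - K₁ᵀ * p.R := by
    rw [← t₁]
    simp only [Matrix.mul_add, Matrix.mul_assoc]
    abel
  have b₁ : K₁ᵀ * (p.Bᵀ * P₁ * p.A) = (p.Sᵀ + p.Aᵀ * P₁ * p.B) * K₁ - K₁ᵀ * p.S := by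
    rw [← t₁, Matrix.mul_assoc K₁ᵀ, t₁']
    simp only [Matrix.mul_add, Matrix.mul_assoc]
    abel
  have a₂ : (p.Bᵀ * P₂ * p.B) * K₂ = p.S + p.Bᵀ * P₂ * p.A - p.R * K₂ := by
    rw [← t₂]
    simp only [Matrix.add_mul, Matrix.mul_assoc]
    abel
  have c₁ : (p.A - p.B * K₁)ᵀ * P₁ * (p.A - p.B * K₂)
      = P₁ - p.Q + K₁ᵀ * p.S + p.Sᵀ * K₂ - K₁ᵀ * p.R * K₂ := by
    calc _ = p.Aᵀ * P₁ * p.A - K₁ᵀ * (p.Bᵀ * P₁ * p.A) - p.Aᵀ * P₁ * p.B * K₂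
          + K₁ᵀ * (p.Bᵀ * P₁ * p.B) * K₂ := by
          rw [Matrix.transpose_sub, Matrix.transpose_mul]
          simp only [Matrix.mul_sub, Matrix.sub_mul, Matrix.mul_assoc]
          abel
      _ = (p.Q + p.Aᵀ * P₁ * p.A - (p.Sᵀ + p.Aᵀ * P₁ * p.B) * K₁) - p.Q + K₁ᵀ * p.S
          + p.Sᵀ * K₂ - K₁ᵀ * p.R * K₂ := by
          rw [a₁, b₁]
          simp only [Matrix.add_mul, Matrix.sub_mul, Matrix.mul_assoc]
          abel
      _ = _ := by rw [← e₁]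
  have c₂ : (p.A - p.B * K₁)ᵀ * P₂ * (p.A - p.B * K₂)
      = P₂ - p.Q + K₁ᵀ * p.S + p.Sᵀ * K₂ - K₁ᵀ * p.R * K₂ := by
    calc _ = p.Aᵀ * P₂ * p.A - K₁ᵀ * (p.Bᵀ * P₂ * p.A) - p.Aᵀ * P₂ * p.B * K₂
          + K₁ᵀ * ((p.Bᵀ * P₂ * p.B) * K₂) := by
          rw [Matrix.transpose_sub, Matrix.transpose_mul]
          simp only [Matrix.mul_sub, Matrix.sub_mul, Matrix.mul_assoc]
          abel
      _ = (p.Q + p.Aᵀ * P₂ * p.A - (p.Sᵀ + p.Aᵀ * P₂ * p.B) * K₂) - p.Q + K₁ᵀ * p.S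
          + p.Sᵀ * K₂ - K₁ᵀ * p.R * K₂ := by
          rw [a₂]
          simp only [Matrix.mul_add, Matrix.add_mul, Matrix.mul_sub, Matrix.mul_assoc]
          abel
      _ = _ := by rw [← e₂]
  rw [Matrix.mul_sub _ P₁, Matrix.sub_mul _ _ (p.A - p.B * K₂), c₁, c₂]
  simp only [Matrix.mul_assoc]
  abel

theorem IsStabilizingDARESolution.unique {P₁ P₂ : Matrix (Fin n) (Fin n) ℝ} (hR : p.R.IsSymm)
    (h₁ : p.IsStabilizingDARESolution P₁) (h₂ : p.IsStabilizingDARESolution P₂) : P₁ = P₂ := by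
  have e := h₁.1.sub_eq hR h₂.1
  set A₁ := p.A - p.B * p.dareGain P₁
  set A₂ := p.A - p.B * p.dareGain P₂
  -- iterating the identity between the two closed loops makes the right-hand side vanish
  have hk : ∀ k : ℕ, P₁ - P₂ = (A₁ ^ k)ᵀ * (P₁ - P₂) * A₂ ^ k := by
    intro k
    induction k with
    | zero => simp
    | succ k ih =>
      conv_lhs => rw [ih, e]
      rw [pow_succ' A₁, pow_succ' A₂, Matrix.transpose_mul]
      simp only [Matrix.mul_assoc]
  have hlim : Tendsto (fun k : ℕ => (A₁ ^ k)ᵀ * (P₁ - P₂) * A₂ ^ k) atTop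
      (𝓝 (0ᵀ * (P₁ - P₂) * 0)) :=
    (((Continuous.matrix_transpose continuous_id).tendsto _ |>.comp h₁.2.tendsto_pow).mul
      tendsto_const_nhds).mul h₂.2.tendsto_pow
  have := tendsto_nhds_unique (tendsto_const_nhds.congr hk) hlim
  simpa [sub_eq_zero] using this

end Algebra

/-! ### The linear-quadratic regulator with positive definite stage cost -/

section Regulator

variable {n m : ℕ} {p : LQProblem n m}

/-- The stage cost is a positive definite quadratic form on state-input pairs. -/
structure HasPosDefCost (p : LQProblem n m) : Prop where
  Q_isSymm : p.Q.IsSymm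
  R_isSymm : p.R.IsSymm
  pos : ∀ x u, (x ≠ 0 ∨ u ≠ 0) → 0 < p.stageCost x u

/-- Every state can be steered to the origin in finitely many steps, encoded as an induction
principle: a set that contains the origin and every state with a successor in it is everything. -/
def SteerableToZero (p : LQProblem n m) : Prop :=
  ∀ s : Set (Fin n → ℝ), 0 ∈ s → (∀ x u, p.A *ᵥ x + p.B *ᵥ u ∈ s → x ∈ s) → ∀ x, x ∈ s

theorem HasPosDefCost.nonneg (hp : p.HasPosDefCost) (x : Fin n → ℝ) (u : Fin m → ℝ) :
    0 ≤ p.stageCost x u := by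
  by_cases h : x ≠ 0 ∨ u ≠ 0
  · exact (hp.pos x u h).le
  · push Not at h
    simp [h.1, h.2]

/-- The stage cost dominates a multiple of every quadratic form in the state, uniformly in the
input. -/
theorem HasPosDefCost.exists_mul_quadForm_le (hp : p.HasPosDefCost)
    (Y : Matrix (Fin n) (Fin n) ℝ) : ∃ κ > 0, ∀ x u, κ * quadForm Y x ≤ p.stageCost x u := by
  obtain ⟨c, hc, h⟩ := exists_mul_le_of_homogeneous
    (E := (Fin n → ℝ) × (Fin m → ℝ)) (φ := fun w => quadForm Y w.1)
    (ψ := fun w => p.stageCost w.1 w.2) ((continuous_quadForm Y).comp continuous_fst)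
    p.continuous_stageCost (fun c w => quadForm_smul Y c w.1)
    (fun c w => p.stageCost_smul c w.1 w.2)
    (fun w hw => hp.pos w.1 w.2 (by
      by_contra! h0
      exact hw (Prod.ext h0.1 h0.2)))
  exact ⟨c, hc, fun x u => h (x, u)⟩

theorem quadForm_inputHessian (P : Matrix (Fin n) (Fin n) ℝ) (u : Fin m → ℝ) :
    quadForm (p.inputHessian P) u = p.stageCost 0 u + quadForm P (p.B *ᵥ u) := by
  simp [quadForm, inputHessian, stageCost_eq, Matrix.add_mulVec, mulVec_dotProduct_eq,
    Matrix.mulVec_mulVec, Matrix.mul_assoc]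

theorem HasPosDefCost.inputHessian_posDef (hp : p.HasPosDefCost) {P : Matrix (Fin n) (Fin n) ℝ}
    (hP : P.IsSymm) (h0 : ∀ x, 0 ≤ quadForm P x) : (p.inputHessian P).PosDef := by
  refine posDef_iff_quadForm.2 ⟨inputHessian_isSymm hp.R_isSymm hP, fun u hu => ?_⟩
  rw [quadForm_inputHessian]
  exact add_pos_of_pos_of_nonneg (hp.pos 0 u (Or.inr hu)) (h0 _)

theorem continuousAt_riccati {P : Matrix (Fin n) (Fin n) ℝ} (hM : IsUnit (p.inputHessian P)) :
    ContinuousAt p.riccati P := by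
  have hdet := (Matrix.isUnit_iff_isUnit_det _).1 hM
  have hinv : ContinuousAt (fun X => (p.inputHessian X)⁻¹) P := by
    refine ContinuousAt.comp (g := Inv.inv) (continuousAt_matrix_inv _ ?_) ?_
    · rw [← hdet.unit_spec]
      exact NormedRing.inverse_continuousAt hdet.unit
    · unfold inputHessian; fun_prop
  have hgain : ContinuousAt p.dareGain P :=
    ContinuousAt.comp (f := fun X => ((p.inputHessian X)⁻¹, p.S + p.Bᵀ * X * p.A))
      (continuous_fst.matrix_mul continuous_snd).continuousAt (hinv.prodMk (by fun_prop))
  exact ContinuousAt.sub (by fun_prop)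
    (ContinuousAt.comp (f := fun X => (p.Sᵀ + p.Aᵀ * X * p.B, p.dareGain X))
      (continuous_fst.matrix_mul continuous_snd).continuousAt
      (ContinuousAt.prodMk (by fun_prop) hgain))

/-- The Riccati iteration started at `0` increases, because it computes the optimal costs of
growing horizons, and it is bounded, because every state can be steered to the origin. -/
theorem HasPosDefCost.exists_tendsto_riccati_iterate (hp : p.HasPosDefCost)
    (hs : p.SteerableToZero) :
    ∃ P : Matrix (Fin n) (Fin n) ℝ, P.IsSymm ∧ (∀ x, 0 ≤ quadForm P x) ∧
      Tendsto (fun k => p.riccati^[k] 0) atTop (𝓝 P) := by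
  set P : ℕ → Matrix (Fin n) (Fin n) ℝ := fun k => p.riccati^[k] 0 with hPdef
  have hsucc : ∀ k, P (k + 1) = p.riccati (P k) := fun k => Function.iterate_succ_apply' _ _ _
  have hinv : ∀ k, (P k).IsSymm ∧ ∀ x, 0 ≤ quadForm (P k) x := by
    intro k
    induction k with
    | zero => exact ⟨Matrix.transpose_zero, fun x => (quadForm_zero_left x).ge⟩
    | succ k ih =>
      have hM := (hp.inputHessian_posDef ih.1 ih.2).isUnit
      rw [hsucc]
      refine ⟨riccati_isSymm hp.Q_isSymm hp.R_isSymm ih.1 hM, fun x => ?_⟩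
      rw [quadForm_riccati hp.R_isSymm ih.1 hM]
      exact add_nonneg (hp.nonneg _ _) (ih.2 _)
  have hM : ∀ k, (p.inputHessian (P k)).PosDef := fun k =>
    hp.inputHessian_posDef (hinv k).1 (hinv k).2
  have hle : ∀ k x u, quadForm (P (k + 1)) x
      ≤ p.stageCost x u + quadForm (P k) (p.A *ᵥ x + p.B *ᵥ u) := fun k x u => by
    rw [hsucc]; exact quadForm_riccati_le hp.R_isSymm (hinv k).1 (hM k) x u
  have hstep : ∀ k x, quadForm (P k) x ≤ quadForm (P (k + 1)) x := by
    intro k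
    induction k with
    | zero => intro x; exact (quadForm_zero_left x).trans_le ((hinv 1).2 x)
    | succ k ih =>
      intro x
      rw [hsucc (k + 1), quadForm_riccati hp.R_isSymm (hinv _).1 (hM _).isUnit]
      exact (hle k x _).trans (by gcongr; exact ih _)
  have hbdd : ∀ x, ∃ c, ∀ k, quadForm (P k) x ≤ c := by
    refine hs {x | ∃ c, ∀ k, quadForm (P k) x ≤ c} ⟨0, fun k => by simp⟩ ?_
    rintro x u ⟨c, hc⟩
    refine ⟨p.stageCost x u + c, fun k => (hstep k x).trans ((hle k x u).trans ?_)⟩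
    gcongr
    exact hc k
  have hlim : ∀ x, ∃ c, Tendsto (fun k => quadForm (P k) x) atTop (𝓝 c) := fun x => by
    obtain ⟨c, hc⟩ := hbdd x
    exact ⟨_, tendsto_atTop_ciSup (monotone_nat_of_le_succ fun k => hstep k x)
      ⟨c, by rintro _ ⟨k, rfl⟩; exact hc k⟩⟩
  choose q hq using hlim
  refine ⟨Matrix.of fun i j => (q (Pi.single i 1 + Pi.single j 1) - q (Pi.single i 1)
    - q (Pi.single j 1)) / 2, ?_⟩
  set P' : Matrix (Fin n) (Fin n) ℝ := Matrix.of fun i j =>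
    (q (Pi.single i 1 + Pi.single j 1) - q (Pi.single i 1) - q (Pi.single j 1)) / 2
  have ht : Tendsto P atTop (𝓝 P') := by
    refine tendsto_pi_nhds.2 fun i => tendsto_pi_nhds.2 fun j => ?_
    refine ((((hq _).sub (hq _)).sub (hq _)).div_const 2).congr fun k => ?_
    exact (entry_eq_quadForm (hinv k).1 i j).symm
  refine ⟨?_, fun x => ?_, ht⟩
  · refine tendsto_nhds_unique ((continuous_id.matrix_transpose.tendsto P').comp ht) ?_
    exact ht.congr fun k => (hinv k).1.symm
  · have hc : Continuous fun M : Matrix (Fin n) (Fin n) ℝ => quadForm M x := by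
      unfold quadForm; fun_prop
    exact ge_of_tendsto' ((hc.tendsto P').comp ht) fun k => (hinv k).2 x

/-- The limit of the Riccati iteration is a fixed point by continuity. It is positive definite
because the stage cost is, and stabilizing because its quadratic form is a Lyapunov function of the
closed loop. -/
theorem HasPosDefCost.exists_stabilizing (hp : p.HasPosDefCost) (hs : p.SteerableToZero) :
    ∃ Y : Matrix (Fin n) (Fin n) ℝ, Y.PosDef ∧ p.IsStabilizingDARESolution Y ∧
      (p.inputHessian Y).PosDef := by
  obtain ⟨Y, hY, h0, ht⟩ := hp.exists_tendsto_riccati_iterate hs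
  have hM := hp.inputHessian_posDef hY h0
  have hfix : Y = p.riccati Y := by
    refine tendsto_nhds_unique ((tendsto_add_atTop_iff_nat 1).2 ht) ?_
    refine ((continuousAt_riccati hM.isUnit).tendsto.comp ht).congr fun k => ?_
    exact (Function.iterate_succ_apply' _ _ _).symm
  have heq : ∀ x, quadForm Y x = p.stageCost x (-(p.dareGain Y *ᵥ x))
      + quadForm Y ((p.A - p.B * p.dareGain Y) *ᵥ x) := fun x => by
    conv_lhs => rw [hfix]
    rw [quadForm_riccati hp.R_isSymm hY hM.isUnit, mulVec_add_mulVec_neg_gain]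
  have hpd : Y.PosDef := posDef_iff_quadForm.2 ⟨hY, fun x hx => by
    rw [heq]; exact add_pos_of_pos_of_nonneg (hp.pos _ _ (Or.inl hx)) (h0 _)⟩
  obtain ⟨κ, hκ, hκle⟩ := hp.exists_mul_quadForm_le Y
  refine ⟨Y, hpd, ⟨⟨hY, hM.isUnit, hfix⟩, ?_⟩, hM⟩
  refine schurStable_of_lyapunov hpd (c := 1 - κ) (by linarith) fun x => ?_
  linarith [heq x, hκle x (-(p.dareGain Y *ᵥ x))]

end Regulator

/-! ### Controllability -/

section Controllability

variable {n m : ℕ} {p : LQProblem n m}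

theorem Controllable.steerableToZero (h : p.Controllable) : p.SteerableToZero := by
  intro s h0 hs x0
  obtain ⟨T, x, u, ⟨hx0, hx⟩, hT⟩ := h x0 0
  have key : ∀ k : Fin (T + 1), x k ∈ s := by
    intro k
    induction k using Fin.reverseInduction with
    | last => rw [hT]; exact h0
    | cast k ih => exact hs _ (u k) (hx k ▸ ih)
  rw [← hx0]
  exact key 0

/-- Dual form of `SteerableToZero`: every state can be reached from the origin. -/
theorem Controllable.mem_of_forward_closed (h : p.Controllable) {s : Set (Fin n → ℝ)}
    (h0 : 0 ∈ s) (hs : ∀ x u, x ∈ s → p.A *ᵥ x + p.B *ᵥ u ∈ s) (y : Fin n → ℝ) : y ∈ s := by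
  obtain ⟨T, x, u, ⟨hx0, hx⟩, hT⟩ := h 0 y
  have key : ∀ k : Fin (T + 1), x k ∈ s := by
    intro k
    induction k using Fin.induction with
    | zero => rw [hx0]; exact h0
    | succ k ih => rw [hx k]; exact hs _ _ ih
  rw [← hT]
  exact key _

/-- By controllability `range A + range B` is everything, so the input can map `ker A` onto a
complement of `range A`. -/
theorem Controllable.exists_isUnit_sub (h : p.Controllable) :
    ∃ K : Matrix (Fin m) (Fin n) ℝ, IsUnit (p.A - p.B * K) := by
  set a := Matrix.toLin' p.A with ha
  set b := Matrix.toLin' p.B with hb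
  set π := (LinearMap.range a).mkQ
  have hsurj : Function.Surjective (π ∘ₗ b) := by
    intro z
    obtain ⟨y, rfl⟩ := Submodule.mkQ_surjective _ z
    refine h.mem_of_forward_closed (s := {y | ∃ u, (π ∘ₗ b) u = π y}) ⟨0, by simp⟩ ?_ y
    rintro x u -
    refine ⟨u, ?_⟩
    have : π (p.A *ᵥ x) = 0 := (Submodule.Quotient.mk_eq_zero _).2 ⟨x, by simp [ha]⟩
    simp [hb, this]
  obtain ⟨σ, hσ⟩ := LinearMap.exists_rightInverse_of_surjective _ (LinearMap.range_eq_top.2 hsurj)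
  obtain ⟨ρ, hρ⟩ := LinearMap.exists_leftInverse_of_injective (LinearMap.ker a).subtype
    (Submodule.ker_subtype _)
  have hfin : Module.finrank ℝ (LinearMap.ker a)
      = Module.finrank ℝ ((Fin n → ℝ) ⧸ LinearMap.range a) := by
    have h1 := LinearMap.finrank_range_add_finrank_ker a
    have h2 := Submodule.finrank_quotient_add_finrank (LinearMap.range a)
    omega
  let e := LinearEquiv.ofFinrankEq _ _ hfin
  let g : (Fin n → ℝ) →ₗ[ℝ] (Fin m → ℝ) := σ ∘ₗ e.toLinearMap ∘ₗ ρ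
  refine ⟨LinearMap.toMatrix' g, ?_⟩
  rw [← Matrix.mulVec_injective_iff_isUnit]
  rw [← Matrix.coe_mulVecLin, ← LinearMap.ker_eq_bot, LinearMap.ker_eq_bot']
  intro x hx
  have hx' : a x = b (g x) := by
    have : p.A *ᵥ x - p.B *ᵥ (LinearMap.toMatrix' g *ᵥ x) = 0 := by
      simpa [Matrix.sub_mulVec] using hx
    rw [LinearMap.toMatrix'_mulVec] at this
    simpa [ha, hb] using sub_eq_zero.1 this
  have hρx : ρ x = 0 := by
    have h1 : (π ∘ₗ b) (g x) = e (ρ x) := LinearMap.congr_fun hσ (e (ρ x))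
    have h2 : (π ∘ₗ b) (g x) = 0 := by
      rw [LinearMap.comp_apply, ← hx']
      exact (Submodule.Quotient.mk_eq_zero _).2 ⟨x, rfl⟩
    rw [h1] at h2
    simpa using h2
  have hax : a x = 0 := by simp [hx', g, hρx]
  have h3 : ρ x = ⟨x, hax⟩ := LinearMap.congr_fun hρ ⟨x, hax⟩
  simpa using congrArg Subtype.val (h3.symm.trans hρx)

end Controllability

/-! ### The reverse Riccati equation -/

section Reverse

variable {n m : ℕ} {p : LQProblem n m} {L : Matrix (Fin n) (Fin n) ℝ}

theorem hasPosDefCost_of_posDef (h : p.stageMatrix.PosDef) : p.HasPosDefCost := by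
  obtain ⟨hQ, -, -, hR⟩ := (Matrix.isHermitian_fromBlocks_iff (A := p.Q) (B := p.Sᵀ) (C := p.S)
    (D := p.R)).1 h.isHermitian
  refine ⟨by simpa [Matrix.IsHermitian, Matrix.IsSymm] using hQ,
    by simpa [Matrix.IsHermitian, Matrix.IsSymm] using hR, fun x u hxu => ?_⟩
  have hne : Sum.elim x u ≠ 0 := by
    intro h0
    rcases hxu with hx | hu
    · exact hx (funext fun i => congrFun h0 (Sum.inl i))
    · exact hu (funext fun i => congrFun h0 (Sum.inr i))
  simpa [stageCost] using h.dotProduct_mulVec_pos hne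

theorem Q_isSymm_of_rotate (hL : L.IsSymm) (h : (p.rotate L).Q.IsSymm) : p.Q.IsSymm := by
  have e : p.Q = (p.rotate L).Q - L + p.Aᵀ * L * p.A := by simp only [rotate]; abel
  rw [e]
  refine (h.sub hL).add ?_
  simp [Matrix.IsSymm, Matrix.transpose_mul, hL.eq, Matrix.mul_assoc]

theorem R_isSymm_of_rotate (hL : L.IsSymm) (h : (p.rotate L).R.IsSymm) : p.R.IsSymm := by
  have e : p.R = (p.rotate L).R + p.Bᵀ * L * p.B := by simp only [rotate]; abel
  rw [e]
  refine h.add ?_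
  simp [Matrix.IsSymm, Matrix.transpose_mul, hL.eq, Matrix.mul_assoc]

/-- The reverse problem of the pre-stabilized data, rotated by `L` and with the sign of the cost
changed. Its cost is the rotated stage cost of `p` along the dynamics run backwards. -/
noncomputable def backward (p : LQProblem n m) (K : Matrix (Fin m) (Fin n) ℝ)
    (L : Matrix (Fin n) (Fin n) ℝ) : LQProblem n m :=
  ((p.preStabilize K).reverse.rotate L).neg

variable {K : Matrix (Fin m) (Fin n) ℝ}

/-- The predecessor of `y` in backward time, moved forward with the corresponding input. -/
theorem backward_step (hK : IsUnit (p.A - p.B * K)) (y : Fin n → ℝ) (v : Fin m → ℝ) :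
    p.A *ᵥ ((p.backward K L).A *ᵥ y + (p.backward K L).B *ᵥ v)
      + p.B *ᵥ (-v - K *ᵥ ((p.backward K L).A *ᵥ y + (p.backward K L).B *ᵥ v)) = y := by
  have hd := (Matrix.isUnit_iff_isUnit_det _).1 hK
  have hx : (p.A - p.B * K) *ᵥ ((p.backward K L).A *ᵥ y + (p.backward K L).B *ᵥ v)
      = y + p.B *ᵥ v := by
    simp [backward, neg, rotate, reverse, preStabilize, Matrix.mulVec_add, Matrix.mulVec_mulVec,
      ← Matrix.mul_assoc, Matrix.mul_nonsing_inv _ hd]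
  rw [Matrix.sub_mulVec, ← Matrix.mulVec_mulVec] at hx
  rw [Matrix.mulVec_sub, Matrix.mulVec_neg]
  linear_combination (exp := 1) hx

/-- Forward steps of `p` are backward steps of `p.backward K L`. -/
theorem backward_step_forward (hK : IsUnit (p.A - p.B * K)) (x : Fin n → ℝ) (u : Fin m → ℝ) :
    (p.backward K L).A *ᵥ (p.A *ᵥ x + p.B *ᵥ u)
      + (p.backward K L).B *ᵥ (-(u + K *ᵥ x)) = x := by
  have hd := (Matrix.isUnit_iff_isUnit_det _).1 hK
  have e : p.A *ᵥ x + p.B *ᵥ u + p.B *ᵥ (-(u + K *ᵥ x)) = (p.A - p.B * K) *ᵥ x := by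
    rw [Matrix.sub_mulVec, ← Matrix.mulVec_mulVec, Matrix.mulVec_neg, Matrix.mulVec_add]
    abel
  simp only [backward, neg, rotate, reverse, preStabilize]
  rw [← Matrix.mulVec_mulVec, ← Matrix.mulVec_add, e, Matrix.mulVec_mulVec,
    Matrix.nonsing_inv_mul _ hd, Matrix.one_mulVec]

theorem preStabilize_Q_isSymm (hQ : p.Q.IsSymm) (hR : p.R.IsSymm) :
    (p.preStabilize K).Q.IsSymm := by
  simp only [preStabilize, Matrix.IsSymm, Matrix.transpose_add, Matrix.transpose_sub,
    Matrix.transpose_mul, Matrix.transpose_transpose, hQ.eq, hR.eq, Matrix.mul_assoc]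
  abel

theorem backward_stageCost (hL : L.IsSymm) (hQ : p.Q.IsSymm) (hR : p.R.IsSymm)
    (hK : IsUnit (p.A - p.B * K)) (y : Fin n → ℝ) (v : Fin m → ℝ) :
    (p.backward K L).stageCost y v
      = (p.rotate L).stageCost ((p.backward K L).A *ᵥ y + (p.backward K L).B *ᵥ v)
        (-v - K *ᵥ ((p.backward K L).A *ᵥ y + (p.backward K L).B *ᵥ v)) := by
  rw [rotate_stageCost _ _ hL, backward_step hK]
  conv_lhs => rw [backward, neg_stageCost, rotate_stageCost _ _ hL,
    reverse_stageCost _ (preStabilize_Q_isSymm hQ hR), preStabilize_stageCost _ hR]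
  simp only [backward, neg, rotate]
  ring

theorem backward_hasPosDefCost (hL : L.IsSymm) (hp : (p.rotate L).HasPosDefCost)
    (hK : IsUnit (p.A - p.B * K)) : (p.backward K L).HasPosDefCost := by
  have hQ := Q_isSymm_of_rotate hL hp.Q_isSymm
  have hR := R_isSymm_of_rotate hL hp.R_isSymm
  have hQ' : (p.preStabilize K).Q.IsSymm := preStabilize_Q_isSymm hQ hR
  refine ⟨?_, ?_, fun y v hyv => ?_⟩
  · simp only [backward, neg, rotate, reverse, Matrix.IsSymm, Matrix.transpose_add,
      Matrix.transpose_sub, Matrix.transpose_mul, Matrix.transpose_neg,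
      Matrix.transpose_transpose, hQ'.eq, hL.eq, Matrix.mul_assoc]
  · have hR' : (p.preStabilize K).Rᵀ = (p.preStabilize K).R := hR
    simp only [backward, neg, rotate, reverse, Matrix.IsSymm, Matrix.transpose_add,
      Matrix.transpose_sub, Matrix.transpose_mul, Matrix.transpose_neg,
      Matrix.transpose_transpose, hQ'.eq, hL.eq, hR', Matrix.mul_assoc]
    abel
  · rw [backward_stageCost hL hQ hR hK]
    have hy := backward_step (L := L) hK y v
    set x := (p.backward K L).A *ᵥ y + (p.backward K L).B *ᵥ v
    refine hp.pos _ _ ?_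
    by_contra! h0
    obtain ⟨hx, hu⟩ := h0
    rw [hu, hx] at hy
    rw [hx] at hu
    rcases hyv with h | h
    · exact h (by simpa using hy.symm)
    · exact h (by simpa using hu)

theorem Controllable.backward_steerableToZero (h : p.Controllable)
    (hK : IsUnit (p.A - p.B * K)) : (p.backward K L).SteerableToZero := by
  intro s h0 hs
  refine h.mem_of_forward_closed h0 fun x u hx => hs _ (-(u + K *ᵥ x)) ?_
  rwa [backward_step_forward hK]

/-- The stabilizing solution of the reverse Riccati equation exists, is unique and equals
`-W - L`, where `W` gives the rotated cost of steering the origin to a given state optimally. -/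
theorem exists_requiredSupply (hctrl : p.Controllable) (hL : L.IsSymm)
    (hp : (p.rotate L).HasPosDefCost) (hK : IsUnit (p.A - p.B * K)) :
    ∃ W : Matrix (Fin n) (Fin n) ℝ, W.PosDef ∧
      (∀ P, (p.preStabilize K).IsStabilizingRDARESolution P ↔ P = -W - L) ∧
      ∀ x u, quadForm W (p.A *ᵥ x + p.B *ᵥ u) ≤ (p.rotate L).stageCost x u + quadForm W x := by
  have hg := backward_hasPosDefCost hL hp hK
  obtain ⟨W, hW, hst, hM⟩ := hg.exists_stabilizing (hctrl.backward_steerableToZero hK)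
  have hiff : ∀ P, (p.preStabilize K).IsStabilizingRDARESolution P ↔
      (p.backward K L).IsStabilizingDARESolution (-(P + L)) := fun P => by
    rw [backward, neg_isStabilizingDARESolution, neg_neg, rotate_isStabilizingDARESolution _ hL]
    rfl
  refine ⟨W, hW, fun P => ?_, fun x u => ?_⟩
  · rw [hiff]
    constructor
    · intro h
      rw [hst.unique hg.R_isSymm h]
      abel
    · rintro rfl
      simpa using hst
  · have h := quadForm_riccati_le hg.R_isSymm hst.1.1 hM (p.A *ᵥ x + p.B *ᵥ u) (-(u + K *ᵥ x))
    have hfix : (p.backward K L).riccati W = W := hst.1.2.2.symm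
    rw [hfix, backward_stageCost hL (Q_isSymm_of_rotate hL hp.Q_isSymm)
      (R_isSymm_of_rotate hL hp.R_isSymm) hK, backward_step_forward hK] at h
    simpa using h

end Reverse

/-! ### Finite horizons -/

section FiniteHorizon

variable {n m : ℕ} {p : LQProblem n m}

theorem isFeasible_succ_iff {N : ℕ} {x0 : Fin n → ℝ} {x : Fin (N + 2) → Fin n → ℝ}
    {u : Fin (N + 1) → Fin m → ℝ} :
    p.IsFeasible x0 x u ↔
      x 0 = x0 ∧ p.IsFeasible (p.A *ᵥ x0 + p.B *ᵥ u 0) (Fin.tail x) (Fin.tail u) := by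
  unfold IsFeasible
  rw [Fin.forall_fin_succ]
  constructor
  · rintro ⟨rfl, h0, h⟩
    exact ⟨rfl, h0, h⟩
  · rintro ⟨rfl, h0, h⟩
    exact ⟨rfl, h0, h⟩

theorem horizonCost_succ (F : Matrix (Fin n) (Fin n) ℝ) {N : ℕ} (x : Fin (N + 2) → Fin n → ℝ)
    (u : Fin (N + 1) → Fin m → ℝ) :
    p.horizonCost F x u
      = p.stageCost (x 0) (u 0) + p.horizonCost F (Fin.tail x) (Fin.tail u) := by
  unfold horizonCost
  rw [Fin.sum_univ_succ, add_assoc]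
  rfl

/-- Rotation changes the cost of all feasible pairs by the same constant if the terminal cost
matrix is shifted by `L`. -/
theorem horizonCost_rotate {L : Matrix (Fin n) (Fin n) ℝ} (hL : L.IsSymm)
    (F : Matrix (Fin n) (Fin n) ℝ) {N : ℕ} {x0 : Fin n → ℝ} {x : Fin (N + 1) → Fin n → ℝ}
    {u : Fin N → Fin m → ℝ} (h : p.IsFeasible x0 x u) :
    (p.rotate L).horizonCost (F + L) x u = p.horizonCost F x u + quadForm L x0 := by
  induction N generalizing x0 with
  | zero =>
    obtain ⟨rfl, -⟩ := h
    simp [horizonCost, quadForm, Matrix.add_mulVec]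
  | succ N ih =>
    obtain ⟨rfl, h⟩ := isFeasible_succ_iff.1 h
    rw [horizonCost_succ, horizonCost_succ, ih h, rotate_stageCost _ _ hL]
    ring

theorem isOptimal_rotate_iff {L : Matrix (Fin n) (Fin n) ℝ} (hL : L.IsSymm)
    (F : Matrix (Fin n) (Fin n) ℝ) {N : ℕ} {x0 : Fin n → ℝ} {x : Fin (N + 1) → Fin n → ℝ}
    {u : Fin N → Fin m → ℝ} :
    (p.rotate L).IsOptimal (F + L) x0 x u ↔ p.IsOptimal F x0 x u := by
  have hf : ∀ (x' : Fin (N + 1) → Fin n → ℝ) (u' : Fin N → Fin m → ℝ),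
      (p.rotate L).IsFeasible x0 x' u' ↔ p.IsFeasible x0 x' u' := fun _ _ => Iff.rfl
  unfold IsOptimal
  simp only [hf]
  refine and_congr_right fun h => forall₂_congr fun x' u' => imp_congr_right fun h' => ?_
  rw [horizonCost_rotate hL F h, horizonCost_rotate hL F h', add_le_add_iff_right]

/-- The terminal cost matrix `P` lies strictly above `-W`, where the positive definite `W` is a
storage function for the positive definite stage cost. -/
structure HasStorageBound (p : LQProblem n m) (W P : Matrix (Fin n) (Fin n) ℝ) : Prop where
  cost : p.HasPosDefCost
  posDef : W.PosDef
  storage : ∀ x u, quadForm W (p.A *ᵥ x + p.B *ᵥ u) ≤ p.stageCost x u + quadForm W x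
  isSymm : P.IsSymm
  pos : ∀ x, x ≠ 0 → 0 < quadForm (P + W) x

variable {W P F : Matrix (Fin n) (Fin n) ℝ}

theorem HasStorageBound.inputHessian_posDef (h : p.HasStorageBound W P) :
    (p.inputHessian P).PosDef := by
  refine posDef_iff_quadForm.2 ⟨inputHessian_isSymm h.cost.R_isSymm h.isSymm, fun u hu => ?_⟩
  rw [quadForm_inputHessian]
  rcases eq_or_ne (p.B *ᵥ u) 0 with h0 | h0
  · simpa [h0] using h.cost.pos 0 u (Or.inr hu)
  · have h1 := h.storage 0 u
    have h2 := h.pos _ h0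
    rw [quadForm_add] at h2
    simp only [Matrix.mulVec_zero, zero_add, quadForm_zero_right, add_zero] at h1
    linarith

/-- Dynamic programming preserves the lower bound `-W`. -/
theorem HasStorageBound.riccati (h : p.HasStorageBound W P) :
    p.HasStorageBound W (p.riccati P) := by
  have hM := h.inputHessian_posDef
  refine ⟨h.cost, h.posDef, h.storage,
    riccati_isSymm h.cost.Q_isSymm h.cost.R_isSymm h.isSymm hM.isUnit, fun x hx => ?_⟩
  rw [quadForm_add, quadForm_riccati h.cost.R_isSymm h.isSymm hM.isUnit]
  set u := -(p.dareGain P *ᵥ x)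
  set y := p.A *ᵥ x + p.B *ᵥ u with hy
  have h1 := h.storage x u
  rcases eq_or_ne y 0 with h0 | h0
  · have h2 := h.cost.pos x u (Or.inl hx)
    have h3 := quadForm_nonneg_of_posDef h.posDef x
    rw [h0, quadForm_zero_right]
    linarith
  · have h2 := h.pos y h0
    rw [quadForm_add] at h2
    rw [← hy] at h1
    linarith

theorem HasStorageBound.riccati_iterate (h : p.HasStorageBound W F) (k : ℕ) :
    p.HasStorageBound W (p.riccati^[k] F) := by
  induction k with
  | zero => exact h
  | succ k ih => rw [Function.iterate_succ_apply']; exact ih.riccati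

theorem HasStorageBound.quadForm_le_horizonCost (h : p.HasStorageBound W F) {N : ℕ}
    {x0 : Fin n → ℝ} {x : Fin (N + 1) → Fin n → ℝ} {u : Fin N → Fin m → ℝ}
    (hf : p.IsFeasible x0 x u) : quadForm (p.riccati^[N] F) x0 ≤ p.horizonCost F x u := by
  induction N generalizing x0 with
  | zero =>
    obtain ⟨rfl, -⟩ := hf
    simp [horizonCost, quadForm]
  | succ N ih =>
    obtain ⟨rfl, hf⟩ := isFeasible_succ_iff.1 hf
    have hN := h.riccati_iterate N
    rw [horizonCost_succ, Function.iterate_succ_apply']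
    exact (quadForm_riccati_le h.cost.R_isSymm hN.isSymm hN.inputHessian_posDef _ (u 0)).trans
      (by gcongr; exact ih hf)

/-- Equality in the Bellman inequality forces the first input to be the feedback, and equality
for the remaining horizon. -/
theorem HasStorageBound.eq_of_horizonCost_le (h : p.HasStorageBound W F) {N : ℕ}
    {x0 : Fin n → ℝ} {x : Fin (N + 2) → Fin n → ℝ} {u : Fin (N + 1) → Fin m → ℝ}
    (hf : p.IsFeasible x0 x u) (hle : p.horizonCost F x u ≤ quadForm (p.riccati^[N + 1] F) x0) :
    u 0 = -(p.dareGain (p.riccati^[N] F) *ᵥ x0) ∧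
      p.horizonCost F (Fin.tail x) (Fin.tail u)
        ≤ quadForm (p.riccati^[N] F) (p.A *ᵥ x0 + p.B *ᵥ u 0) := by
  obtain ⟨rfl, hf⟩ := isFeasible_succ_iff.1 hf
  have hN := h.riccati_iterate N
  have hM := hN.inputHessian_posDef
  have h1 := h.quadForm_le_horizonCost hf
  have h2 := stageCost_add_quadForm h.cost.R_isSymm hN.isSymm hM.isUnit (x 0) (u 0)
  rw [horizonCost_succ, Function.iterate_succ_apply'] at hle
  have h3 := quadForm_nonneg_of_posDef hM (u 0 + p.dareGain (p.riccati^[N] F) *ᵥ x 0)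
  refine ⟨?_, by linarith⟩
  by_contra hne
  have h4 := quadForm_pos_of_posDef hM (x := u 0 + p.dareGain (p.riccati^[N] F) *ᵥ x 0)
    fun h0 => hne (eq_neg_of_add_eq_zero_left h0)
  linarith

theorem HasStorageBound.exists_horizonCost_eq (h : p.HasStorageBound W F) (N : ℕ)
    (x0 : Fin n → ℝ) : ∃ (x : Fin (N + 1) → Fin n → ℝ) (u : Fin N → Fin m → ℝ),
      p.IsFeasible x0 x u ∧ p.horizonCost F x u = quadForm (p.riccati^[N] F) x0 := by
  induction N generalizing x0 with
  | zero => exact ⟨fun _ => x0, Fin.elim0, ⟨rfl, fun k => k.elim0⟩,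
      by simp [horizonCost, quadForm]⟩
  | succ N ih =>
    have hN := h.riccati_iterate N
    set u0 := -(p.dareGain (p.riccati^[N] F) *ᵥ x0) with hu0
    obtain ⟨x, u, hf, hc⟩ := ih (p.A *ᵥ x0 + p.B *ᵥ u0)
    refine ⟨Fin.cons x0 x, Fin.cons u0 u, isFeasible_succ_iff.2 ⟨rfl, by simpa using hf⟩, ?_⟩
    rw [horizonCost_succ, Function.iterate_succ_apply',
      quadForm_riccati h.cost.R_isSymm hN.isSymm hN.inputHessian_posDef.isUnit]
    simp [hc, hu0]

theorem HasStorageBound.unique_of_horizonCost_le (h : p.HasStorageBound W F) {N : ℕ}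
    {x0 : Fin n → ℝ} {x x' : Fin (N + 1) → Fin n → ℝ} {u u' : Fin N → Fin m → ℝ}
    (hf : p.IsFeasible x0 x u) (hle : p.horizonCost F x u ≤ quadForm (p.riccati^[N] F) x0)
    (hf' : p.IsFeasible x0 x' u') (hle' : p.horizonCost F x' u' ≤ quadForm (p.riccati^[N] F) x0) :
    x = x' ∧ u = u' := by
  induction N generalizing x0 with
  | zero =>
    refine ⟨funext fun k => ?_, funext fun k => k.elim0⟩
    obtain rfl : k = 0 := Fin.fin_one_eq_zero k
    rw [hf.1, hf'.1]
  | succ N ih =>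
    obtain ⟨e, hle⟩ := h.eq_of_horizonCost_le hf hle
    obtain ⟨e', hle'⟩ := h.eq_of_horizonCost_le hf' hle'
    obtain ⟨hx, hf⟩ := isFeasible_succ_iff.1 hf
    obtain ⟨hx', hf'⟩ := isFeasible_succ_iff.1 hf'
    rw [e] at hf hle
    rw [e'] at hf' hle'
    obtain ⟨h1, h2⟩ := ih hf hle hf' hle'
    rw [← Fin.cons_self_tail x, ← Fin.cons_self_tail x', ← Fin.cons_self_tail u,
      ← Fin.cons_self_tail u', h1, h2, hx, hx', e, e']
    exact ⟨rfl, rfl⟩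

theorem HasStorageBound.isOptimal_iff (h : p.HasStorageBound W F) {N : ℕ}
    {x0 : Fin n → ℝ} {x : Fin (N + 1) → Fin n → ℝ} {u : Fin N → Fin m → ℝ} :
    p.IsOptimal F x0 x u ↔
      p.IsFeasible x0 x u ∧ p.horizonCost F x u ≤ quadForm (p.riccati^[N] F) x0 := by
  refine and_congr_right fun hf => ⟨fun hopt => ?_, fun hle x' u' hf' => ?_⟩
  · obtain ⟨x', u', hf', hc⟩ := h.exists_horizonCost_eq N x0
    exact hc ▸ hopt x' u' hf'
  · exact hle.trans (h.quadForm_le_horizonCost hf')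

theorem HasStorageBound.existsUnique_isOptimal (h : p.HasStorageBound W F) (N : ℕ)
    (x0 : Fin n → ℝ) : ∃! w : (Fin (N + 1) → Fin n → ℝ) × (Fin N → Fin m → ℝ),
      p.IsOptimal F x0 w.1 w.2 := by
  obtain ⟨x, u, hf, hc⟩ := h.exists_horizonCost_eq N x0
  refine ⟨(x, u), h.isOptimal_iff.2 ⟨hf, hc.le⟩, fun w hw => ?_⟩
  obtain ⟨hf', hle'⟩ := h.isOptimal_iff.1 hw
  obtain ⟨h1, h2⟩ := h.unique_of_horizonCost_le hf' hle' hf hc.le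
  exact Prod.ext h1 h2

/-! ### Convergence of the Riccati iteration -/

/-- Upper bound: along the optimal stationary feedback the excess over the infinite-horizon cost
contracts. -/
theorem HasStorageBound.exists_riccati_iterate_le (h : p.HasStorageBound W F)
    {Y : Matrix (Fin n) (Fin n) ℝ} (hY : Y.PosDef) (hfix : p.riccati Y = Y)
    (hM : IsUnit (p.inputHessian Y)) {κ : ℝ} (hκ1 : κ ≤ 1)
    (hκY : ∀ x u, κ * quadForm Y x ≤ p.stageCost x u) :
    ∃ c, 0 ≤ c ∧ ∀ k x, quadForm (p.riccati^[k] F) x ≤ (1 + c * (1 - κ) ^ k) * quadForm Y x := by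
  have hYs := (posDef_iff_quadForm.1 hY).1
  obtain ⟨c, hc, hcF⟩ := exists_mul_quadForm_le F fun x hx => quadForm_pos_of_posDef hY hx
  refine ⟨c⁻¹, by positivity, fun k => ?_⟩
  induction k with
  | zero =>
    intro x
    have h1 : quadForm F x ≤ c⁻¹ * quadForm Y x := by
      rw [le_inv_mul_iff₀ hc]; exact hcF x
    have h2 := quadForm_nonneg_of_posDef hY x
    simp only [Function.iterate_zero, id, pow_zero, mul_one]
    linarith
  | succ k ih =>
    intro x
    have hk := h.riccati_iterate k
    have heq := quadForm_riccati h.cost.R_isSymm hYs hM x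
    rw [hfix] at heq
    rw [Function.iterate_succ_apply']
    have hle := quadForm_riccati_le h.cost.R_isSymm hk.isSymm hk.inputHessian_posDef x
      (-(p.dareGain Y *ᵥ x))
    have hℓ := hκY x (-(p.dareGain Y *ᵥ x))
    set y := p.A *ᵥ x + p.B *ᵥ (-(p.dareGain Y *ᵥ x))
    have h1 : quadForm Y y ≤ (1 - κ) * quadForm Y x := by linarith
    have h2 : 0 ≤ c⁻¹ * (1 - κ) ^ k := by
      have : 0 ≤ 1 - κ := by linarith
      positivity
    have h3 := mul_le_mul_of_nonneg_left h1 h2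
    have h4 := ih y
    rw [pow_succ]
    linarith

/-- Lower bound, first part: as `P ≥ -s W` with `s < 1`, each step of the iteration gains a fixed
multiple of `W`, so that the iterates become positive semidefinite. -/
theorem HasStorageBound.exists_riccati_iterate_nonneg (h : p.HasStorageBound W F) :
    ∃ k, ∀ x, 0 ≤ quadForm (p.riccati^[k] F) x := by
  obtain ⟨δ, hδ, hδF⟩ := exists_mul_quadForm_le W h.pos
  obtain ⟨κ, hκ, hκW⟩ := h.cost.exists_mul_quadForm_le W
  have key : ∀ (k : ℕ) x,
      -(max 0 (1 - δ - k * (κ * δ))) * quadForm W x ≤ quadForm (p.riccati^[k] F) x := by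
    intro k
    induction k with
    | zero =>
      intro x
      have h1 := hδF x
      rw [quadForm_add] at h1
      have h2 := mul_le_mul_of_nonneg_right (le_max_right 0 (1 - δ))
        (quadForm_nonneg_of_posDef h.posDef x)
      simp only [Nat.cast_zero, zero_mul, sub_zero, Function.iterate_zero, id]
      linarith
    | succ k ih =>
      intro x
      have hk := h.riccati_iterate k
      rw [Function.iterate_succ_apply',
        quadForm_riccati h.cost.R_isSymm hk.isSymm hk.inputHessian_posDef.isUnit]
      set u := -(p.dareGain (p.riccati^[k] F) *ᵥ x)
      have h1 := ih (p.A *ᵥ x + p.B *ᵥ u)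
      have h2 := h.storage x u
      have h3 := hκW x u
      have h4 := h.cost.nonneg x u
      have h5 := quadForm_nonneg_of_posDef h.posDef x
      set y := p.A *ᵥ x + p.B *ᵥ u
      set ℓ := p.stageCost x u
      have hkd : 0 ≤ k * (κ * δ) := by positivity
      push_cast
      rcases le_total (1 - δ - k * (κ * δ)) 0 with hs | hs
      · rw [max_eq_left hs] at h1
        rw [max_eq_left (by nlinarith [mul_pos hκ hδ])]
        linarith
      · rw [max_eq_right hs] at h1
        set s := 1 - δ - k * (κ * δ) with hsdef
        have h6 : s * quadForm W y ≤ s * (ℓ + quadForm W x) := mul_le_mul_of_nonneg_left h2 hs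
        have h7 : δ * ℓ ≤ (1 - s) * ℓ := mul_le_mul_of_nonneg_right (by linarith) h4
        have h8 : δ * (κ * quadForm W x) ≤ δ * ℓ := mul_le_mul_of_nonneg_left h3 hδ.le
        have h9 : (s - κ * δ) * quadForm W x
            ≤ max 0 (1 - δ - (k + 1) * (κ * δ)) * quadForm W x :=
          mul_le_mul_of_nonneg_right (le_max_of_le_right (by linarith)) h5
        linarith
  obtain ⟨k, hk⟩ := exists_nat_ge ((κ * δ)⁻¹)
  refine ⟨k, fun x => ?_⟩
  have h1 : 1 ≤ k * (κ * δ) := by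
    have := mul_le_mul_of_nonneg_right hk (mul_pos hκ hδ).le
    rwa [inv_mul_cancel₀ (mul_pos hκ hδ).ne'] at this
  have h2 := key k x
  rw [max_eq_left (by linarith)] at h2
  linarith

/-- Lower bound, second part: once `P ≥ t Y` with `0 ≤ t ≤ 1`, the defect `1 - t` contracts. -/
theorem HasStorageBound.le_riccati_iterate (h : p.HasStorageBound W F)
    {Y : Matrix (Fin n) (Fin n) ℝ}
    (hYle : ∀ x u, quadForm Y x ≤ p.stageCost x u + quadForm Y (p.A *ᵥ x + p.B *ᵥ u))
    {κ : ℝ} (hκ0 : 0 ≤ κ) (hκ1 : κ ≤ 1)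
    (hκY : ∀ x u, κ * quadForm Y x ≤ p.stageCost x u) {k₀ : ℕ}
    (h0 : ∀ x, 0 ≤ quadForm (p.riccati^[k₀] F) x) (k : ℕ) (x : Fin n → ℝ) :
    (1 - (1 - κ) ^ k) * quadForm Y x ≤ quadForm (p.riccati^[k₀ + k] F) x := by
  induction k generalizing x with
  | zero => simpa using h0 x
  | succ k ih =>
    have hk := h.riccati_iterate (k₀ + k)
    rw [← Nat.add_assoc, Function.iterate_succ_apply',
      quadForm_riccati h.cost.R_isSymm hk.isSymm hk.inputHessian_posDef.isUnit]
    set u := -(p.dareGain (p.riccati^[k₀ + k] F) *ᵥ x)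
    have h1 := ih (p.A *ᵥ x + p.B *ᵥ u)
    have ht0 : 0 ≤ (1 - κ) ^ k := pow_nonneg (by linarith) k
    have ht1 : (1 - κ) ^ k ≤ 1 := pow_le_one₀ (by linarith) (by linarith)
    have h2 := mul_le_mul_of_nonneg_left (hYle x u) (sub_nonneg.2 ht1)
    have h3 := mul_le_mul_of_nonneg_left (hκY x u) ht0
    rw [pow_succ]
    linarith

end FiniteHorizon

end LQProblem

/-! ### Exponential stability -/

section Stability

variable {n : ℕ}

theorem euclNorm_nonneg (x : Fin n → ℝ) : 0 ≤ euclNorm x := norm_nonneg _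

theorem globallyExponentiallyStable_of_lyapunov {T : Set (ℕ → Fin n → ℝ)}
    {Y : Matrix (Fin n) (Fin n) ℝ} (hY : Y.PosDef) {σ : ℝ} (hσ0 : 0 < σ) (hσ1 : σ < 1)
    (h : ∀ z ∈ T, ∀ j, quadForm Y (z (j + 1)) ≤ σ * quadForm Y (z j)) :
    GloballyExponentiallyStable T := by
  obtain ⟨a, ha, haY⟩ := exists_mul_quadForm_le 1 fun x hx => quadForm_pos_of_posDef hY hx
  obtain ⟨b, hb, hbY⟩ := exists_mul_quadForm_le Y fun x hx =>
    quadForm_pos_of_posDef (Matrix.PosDef.one (n := Fin n) (R := ℝ)) hx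
  refine ⟨√(a * b)⁻¹, by positivity, √σ, by positivity, by
    rw [Real.sqrt_lt' one_pos]; simpa using hσ1, fun z hz j => ?_⟩
  have hdecay : quadForm Y (z j) ≤ σ ^ j * quadForm Y (z 0) := by
    induction j with
    | zero => simp
    | succ j ih =>
      calc _ ≤ σ * quadForm Y (z j) := h z hz j
        _ ≤ σ * (σ ^ j * quadForm Y (z 0)) := by gcongr
        _ = _ := by ring
  refine (sq_le_sq₀ (euclNorm_nonneg _)
    (mul_nonneg (by positivity) (euclNorm_nonneg _))).1 ?_
  rw [mul_pow, mul_pow, Real.sq_sqrt (by positivity), ← pow_mul, mul_comm j 2, pow_mul,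
    Real.sq_sqrt hσ0.le, ← quadForm_one, ← quadForm_one]
  have h1 := haY (z j)
  have h2 := mul_le_mul_of_nonneg_left (hbY (z 0)) (pow_nonneg hσ0.le j)
  rw [mul_assoc, le_inv_mul_iff₀ (by positivity)]
  have h3 := mul_le_mul_of_nonneg_left (h1.trans hdecay) hb.le
  linarith

theorem GloballyExponentiallyStable.globallyAsymptoticallyStable {T : Set (ℕ → Fin n → ℝ)}
    (h : GloballyExponentiallyStable T) : GloballyAsymptoticallyStable T := by
  obtain ⟨C, hC, ρ, hρ0, hρ1, h⟩ := h
  refine ⟨fun ε hε => ⟨ε / C, by positivity, fun z hz h0 j => ?_⟩, fun z hz => ?_⟩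
  · calc euclNorm (z j) ≤ C * ρ ^ j * euclNorm (z 0) := h z hz j
      _ ≤ C * 1 * euclNorm (z 0) := by
        have := euclNorm_nonneg (z 0)
        have := pow_le_one₀ (n := j) hρ0.le hρ1.le
        gcongr
      _ < ε := by
        rw [mul_one, mul_comm]
        exact (lt_div_iff₀ hC).1 h0
  · have hlim : Tendsto (fun j => C * ρ ^ j * euclNorm (z 0)) atTop (𝓝 0) := by
      simpa using ((tendsto_pow_atTop_nhds_zero_of_lt_one hρ0.le hρ1).const_mul C).mul_const
        (euclNorm (z 0))
    have hz0 : Tendsto (fun j => WithLp.toLp 2 (z j)) atTop (𝓝 0) :=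
      squeeze_zero_norm (fun j => h z hz j) hlim
    exact ((PiLp.continuous_ofLp 2 fun _ : Fin n => ℝ).tendsto 0).comp hz0

end Stability

namespace LQProblem

section ClosedLoop

variable {n m : ℕ} {p : LQProblem n m} {W F : Matrix (Fin n) (Fin n) ℝ}

theorem HasStorageBound.closedLoop_step (h : p.HasStorageBound W F) {N : ℕ}
    {x0 : Fin n → ℝ} {x : Fin (N + 2) → Fin n → ℝ} {u : Fin (N + 1) → Fin m → ℝ}
    (hopt : p.IsOptimal F x0 x u) :
    quadForm (p.riccati^[N + 1] F) x0 = p.stageCost x0 (u 0)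
      + quadForm (p.riccati^[N] F) (p.A *ᵥ x0 + p.B *ᵥ u 0) := by
  obtain ⟨hf, hle⟩ := h.isOptimal_iff.1 hopt
  have hN := h.riccati_iterate N
  rw [(h.eq_of_horizonCost_le hf hle).1, Function.iterate_succ_apply',
    quadForm_riccati h.cost.R_isSymm hN.isSymm hN.inputHessian_posDef.isUnit]

/-- The infinite-horizon optimal cost `Y` is a common Lyapunov function of the receding-horizon
closed loops with long horizons: once the iterates `P` of both horizons satisfy
`(1 - κ/4) Y ≤ P ≤ (1 + κ/4) Y`, the stage cost, at least `κ Y`, outweighs the errors. -/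
theorem HasStorageBound.exists_horizon_stable (h : p.HasStorageBound W F)
    (hs : p.SteerableToZero) : ∃ N₀ : ℕ, ∀ (N : ℕ) (hN : 0 < N), N₀ ≤ N →
      GloballyExponentiallyStable {z | p.IsClosedLoop F N hN z} := by
  obtain ⟨Y, hY, ⟨⟨hYs, -, hfix⟩, -⟩, hM⟩ := h.cost.exists_stabilizing hs
  replace hfix : p.riccati Y = Y := hfix.symm
  have hYnn := quadForm_nonneg_of_posDef hY
  have hYle : ∀ x u, quadForm Y x ≤ p.stageCost x u + quadForm Y (p.A *ᵥ x + p.B *ᵥ u) :=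
    fun x u => by
      have := quadForm_riccati_le h.cost.R_isSymm hYs hM x u
      rwa [hfix] at this
  obtain ⟨κ', hκ', hκY'⟩ := h.cost.exists_mul_quadForm_le Y
  obtain ⟨κ, hκ0, hκ1, hκY⟩ : ∃ κ : ℝ, 0 < κ ∧ κ < 1 ∧
      ∀ x u, κ * quadForm Y x ≤ p.stageCost x u :=
    ⟨min κ' (1 / 2), by positivity, (min_le_right _ _).trans_lt (by norm_num), fun x u =>
      (mul_le_mul_of_nonneg_right (min_le_left _ _) (hYnn x)).trans (hκY' x u)⟩
  obtain ⟨c, hc, hup⟩ := h.exists_riccati_iterate_le hY hfix hM.isUnit hκ1.le hκY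
  obtain ⟨k₀, hk₀⟩ := h.exists_riccati_iterate_nonneg
  have hlow := h.le_riccati_iterate hYle hκ0.le hκ1.le hκY hk₀
  have hpow : Tendsto (fun k : ℕ => (1 - κ) ^ k) atTop (𝓝 0) :=
    tendsto_pow_atTop_nhds_zero_of_lt_one (by linarith) (by linarith)
  have hpow' : Tendsto (fun k : ℕ => c * (1 - κ) ^ k) atTop (𝓝 0) := by
    simpa using hpow.const_mul c
  obtain ⟨k₁, hk₁⟩ := eventually_atTop.1
    ((hpow.eventually_lt_const (show 0 < κ / 4 by positivity)).and
      (hpow'.eventually_lt_const (show 0 < κ / 4 by positivity)))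
  refine ⟨k₀ + k₁ + 1, fun N hN hle => ?_⟩
  obtain ⟨k, hk, rfl⟩ : ∃ k, k₁ ≤ k ∧ N = k₀ + k + 1 := ⟨N - k₀ - 1, by omega, by omega⟩
  have hden : 0 < 1 - κ / 4 := by linarith
  refine globallyExponentiallyStable_of_lyapunov hY (σ := (1 - 3 * κ / 4) / (1 - κ / 4))
    (div_pos (by linarith) hden) ((div_lt_one hden).2 (by linarith)) fun z hz j => ?_
  obtain ⟨x, u, hopt, hz'⟩ := hz j
  have hstep := h.closedLoop_step hopt
  change z (j + 1) = p.A *ᵥ z j + p.B *ᵥ u 0 at hz'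
  rw [← hz'] at hstep
  rw [div_mul_eq_mul_div, le_div_iff₀ hden]
  have h1 : (1 - κ / 4) * quadForm Y (z (j + 1))
      ≤ quadForm (p.riccati^[k₀ + k] F) (z (j + 1)) :=
    (mul_le_mul_of_nonneg_right (by linarith [(hk₁ k hk).1]) (hYnn _)).trans (hlow k _)
  have h2 : quadForm (p.riccati^[k₀ + k + 1] F) (z j) ≤ (1 + κ / 4) * quadForm Y (z j) :=
    (hup _ _).trans (mul_le_mul_of_nonneg_right
      (by linarith [(hk₁ (k₀ + k + 1) (by omega)).2]) (hYnn _))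
  have h3 := hκY (z j) (u 0)
  linarith

theorem isClosedLoop_rotate_iff {L : Matrix (Fin n) (Fin n) ℝ} (hL : L.IsSymm) {N : ℕ}
    (hN : 0 < N) (z : ℕ → Fin n → ℝ) :
    (p.rotate L).IsClosedLoop (F + L) N hN z ↔ p.IsClosedLoop F N hN z := by
  unfold IsClosedLoop
  simp only [isOptimal_rotate_iff hL]
  rfl

end ClosedLoop

end LQProblem

theorem mainTheorem1 {n m : ℕ} (p : LQProblem n m)
    (hctrl : p.Controllable) (hdiss : p.StrictlyPreDissipative) :
    (∃ K : Matrix (Fin m) (Fin n) ℝ, IsUnit (p.A - p.B * K)) ∧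
    ∀ K : Matrix (Fin m) (Fin n) ℝ, IsUnit (p.A - p.B * K) →
      (∃! P : Matrix (Fin n) (Fin n) ℝ, (p.preStabilize K).IsStabilizingRDARESolution P) ∧
      ∀ Pbar : Matrix (Fin n) (Fin n) ℝ, (p.preStabilize K).IsStabilizingRDARESolution Pbar →
        ∀ Pf : Matrix (Fin n) (Fin n) ℝ, (Pf - Pbar).PosDef →
          ∃ N₀ : ℕ, ∀ (N : ℕ) (hN : 0 < N), N₀ ≤ N →
            (∀ x0 : Fin n → ℝ,
              ∃! w : (Fin (N + 1) → Fin n → ℝ) × (Fin N → Fin m → ℝ),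
                p.IsOptimal Pf x0 w.1 w.2) ∧
            GloballyAsymptoticallyStable {z | p.IsClosedLoop Pf N hN z} ∧
            GloballyExponentiallyStable {z | p.IsClosedLoop Pf N hN z} := by
  obtain ⟨L, hL, hLpos⟩ := hdiss
  have hp := LQProblem.hasPosDefCost_of_posDef hLpos
  refine ⟨hctrl.exists_isUnit_sub, fun K hK => ?_⟩
  obtain ⟨W, hW, hiff, hstore⟩ := LQProblem.exists_requiredSupply hctrl hL hp hK
  refine ⟨⟨-W - L, (hiff _).2 rfl, fun P hP => (hiff P).1 hP⟩, fun Pbar hPbar Pf hPf => ?_⟩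
  obtain rfl := (hiff Pbar).1 hPbar
  have e : Pf - (-W - L) = Pf + L + W := by abel
  rw [e] at hPf
  have hsymm : (Pf + L).IsSymm := by
    simpa using (posDef_iff_quadForm.1 hPf).1.sub (posDef_iff_quadForm.1 hW).1
  have hb : (p.rotate L).HasStorageBound W (Pf + L) :=
    ⟨hp, hW, hstore, hsymm, (posDef_iff_quadForm.1 hPf).2⟩
  have hsteer : (p.rotate L).SteerableToZero := hctrl.steerableToZero
  obtain ⟨N₀, hN₀⟩ := hb.exists_horizon_stable hsteer
  refine ⟨N₀, fun N hN hle => ?_⟩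
  have hstab := hN₀ N hN hle
  simp only [LQProblem.isClosedLoop_rotate_iff hL] at hstab
  refine ⟨fun x0 => ?_, hstab.globallyAsymptoticallyStable, hstab⟩
  simpa only [LQProblem.isOptimal_rotate_iff hL] using hb.existsUnique_isOptimal N x0
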